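/- Let $M$ be a compact, simply connected, smooth $n$-dimensional manifold with nonempty boundary $\partial M$. A Finsler norm on $M$ is a function $F\colon TM\to[0,\infty)$ which is smooth on $TM\setminus\{0\}$, satisfies $F(x,y)=0$ if and only if $y=0$, satisfies $F(x,\lambda y)=\lambda F(x,y)$ for all $\lambda\ge 0$, and for which $g_{ij}(x,y)=\frac12\frac{\partial^2F^2}{\partial y^i\partial y^j}(x,y)$ is positive definite whenever $y\neq0$. It is reversible if $F(x,-y)=F(x,y)$ for all $x\in M$ and $y\in T_xM$. A geodesic of $F$ is a smooth curve in $M$ with nowhere vanishing velocity such that $\ddot\gamma^i+2G^i(\gamma,\dot\gamma)=0$, where $G^i=\frac14g^{il}\left(y^k\frac{\partial^2F^2}{\partial x^k\partial y^l}-\frac{\partial F^2}{\partial x^l}\right)$. The length of a curve $\gamma\colon[a,b]\to M$ is $L_F(\gamma)=\int_a^bF(\gamma(t),\dot\gamma(t))\,dt$. We call $F$ admissible if for any two distinct points $x,x'\in\partial M$ there is, up to affine changes of the parameter, a unique geodesic $\gamma$ of $F$ of finite length going from $x$ to $x'$; the boundary distance data of an admissible $F$ is then the map $d_F\colon\partial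 M\times\partial M\to[0,\infty)$ given by $d_F(x,x')=L_F(\gamma)$ for $x\ne x'$ and $d_F(x,x)=0$. For $i\in\{1,2\}$ let $F_{r,i}$ be an admissible reversible Finsler norm on $M$ and let $\beta_i$ be a smooth closed 1-form on $M$ with $$\|\beta_i\|_{F_{r,i}^*}:=\sup_{x\in M}\ \sup_{y\in T_xM,\ F_{r,i}(x,y)=1}\beta_i(x)(y)<1,$$ and suppose that the Finsler norm $F_i=F_{r,i}+\beta_i$ is admissible. Then the following are equivalent: (i) $d_{F_1}(x,x')=d_{F_2}(x,x')$ for all $x,x'\in\partial M$. (ii) There is a unique smooth function $\phi\colon M\to\mathbb R$ vanishing on $\partial M$ such that $\beta_2=\beta_1+d\phi$, and $d_{F_{r,1}}(x,x')=d_{F_{r,2}}(x,x')$ for all $x,x'\in\partial M$. -/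

import Mathlib

open scoped Manifold ContDiff Bundle

noncomputable section

namespace Finsler

variable {n : ℕ} [NeZero n] {M : Type*} [TopologicalSpace M]
  [ChartedSpace (EuclideanHalfSpace n) M]

/-! Throughout, `M` is a smooth `n`-dimensional manifold with boundary, modelled on the closed
half space by `𝓡∂ n`; its tangent spaces are copies of `EuclideanSpace ℝ (Fin n)`. -/

/-- A Finsler norm: a nonnegative function on the tangent bundle, smooth off the zero section,
positive off the zero section, positively homogeneous of degree one, and such that the fibrewise
Hessian of `F ^ 2 / 2` is positive definite at every nonzero tangent vector. -/
structure IsFinslerNorm [IsManifold (𝓡∂ n) ∞ M] (F : TangentBundle (𝓡∂ n) M → ℝ) : Prop where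
  nonneg : ∀ v, 0 ≤ F v
  smooth : ContMDiffOn (𝓡∂ n).tangent 𝓘(ℝ, ℝ) ∞ F {v | v.2 ≠ 0}
  eq_zero_iff : ∀ (x : M) (y : TangentSpace (𝓡∂ n) x), F ⟨x, y⟩ = 0 ↔ y = 0
  homogeneous : ∀ (x : M) (y : TangentSpace (𝓡∂ n) x) (c : ℝ), 0 ≤ c → F ⟨x, c • y⟩ = c * F ⟨x, y⟩
  convex : ∀ (x : M) (y w : EuclideanSpace ℝ (Fin n)), y ≠ 0 → w ≠ 0 →
    0 < (1 / 2 : ℝ) * fderiv ℝ (fun v : EuclideanSpace ℝ (Fin n) =>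
      fderiv ℝ (fun v' : EuclideanSpace ℝ (Fin n) => F ⟨x, v'⟩ ^ 2) v w) y w

/-- `F` is reversible (absolutely homogeneous): `F(x, -y) = F(x, y)`. -/
def IsReversible (F : TangentBundle (𝓡∂ n) M → ℝ) : Prop :=
  ∀ (x : M) (y : TangentSpace (𝓡∂ n) x), F ⟨x, -y⟩ = F ⟨x, y⟩

/-- A (not necessarily continuous) field of covectors on `M`. -/
abbrev CovectorField (n : ℕ) [NeZero n] (M : Type*) [TopologicalSpace M]
    [ChartedSpace (EuclideanHalfSpace n) M] : Type _ :=
  ∀ x : M, TangentSpace (𝓡∂ n) x →L[ℝ] ℝ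

/-- A smooth 1-form: a smooth section of the cotangent bundle. -/
def IsSmoothOneForm [IsManifold (𝓡∂ n) ∞ M] (β : CovectorField n M) : Prop :=
  ContMDiff (𝓡∂ n) ((𝓡∂ n).prod 𝓘(ℝ, EuclideanSpace ℝ (Fin n) →L[ℝ] ℝ)) ∞
    (fun x : M => Bundle.TotalSpace.mk' (EuclideanSpace ℝ (Fin n) →L[ℝ] ℝ)
      (E := fun x : M => TangentSpace (𝓡∂ n) x →L[ℝ] Bundle.Trivial M ℝ x) x (β x))

/-- The differential `dφ` of a scalar field. -/
def differential (φ : M → ℝ) : CovectorField n M :=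
  fun x => mfderiv (𝓡∂ n) 𝓘(ℝ, ℝ) φ x

/-- The tangent vector of `M` with coordinates `(p, y)` in the chart centred at `a`. -/
def tangentOfChart (a : M) (p y : EuclideanSpace ℝ (Fin n)) : TangentBundle (𝓡∂ n) M :=
  ⟨(extChartAt (𝓡∂ n) a).symm p,
    mfderivWithin 𝓘(ℝ, EuclideanSpace ℝ (Fin n)) (𝓡∂ n) (extChartAt (𝓡∂ n) a).symm
      (Set.range (𝓡∂ n)) p y⟩

/-- The 1-form `β` is closed, `dβ = 0`: in every chart `∂_v (β w) = ∂_w (β v)` for all constant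
coordinate fields `v`, `w`. Derivatives are taken within the range of the model, that is within
the closed half space, and are one-sided at boundary points. -/
def IsClosedForm (β : CovectorField n M) : Prop :=
  ∀ (a : M), ∀ p ∈ (extChartAt (𝓡∂ n) a).target, ∀ v w : EuclideanSpace ℝ (Fin n),
    fderivWithin ℝ (fun q => β (tangentOfChart a q w).1 (tangentOfChart a q w).2)
      (Set.range (𝓡∂ n)) p v =
    fderivWithin ℝ (fun q => β (tangentOfChart a q v).1 (tangentOfChart a q v).2)
      (Set.range (𝓡∂ n)) p w

/-- The co-Finsler norm `F*(x, ξ) = sup {ξ y : F(x, y) = 1}` (an extended real supremum). -/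
def coNorm (F : TangentBundle (𝓡∂ n) M → ℝ) (x : M) (ξ : TangentSpace (𝓡∂ n) x →L[ℝ] ℝ) :
    EReal :=
  ⨆ (y : TangentSpace (𝓡∂ n) x) (_ : F ⟨x, y⟩ = 1), ((ξ y : ℝ) : EReal)

/-- The dual norm `‖β‖_{F*} = sup_x F*(x, β(x))` of a 1-form. -/
def dualNorm (F : TangentBundle (𝓡∂ n) M → ℝ) (β : CovectorField n M) : EReal :=
  ⨆ x : M, coNorm F x (β x)

/-- The function `F + β` on the tangent bundle. -/
def addForm (F : TangentBundle (𝓡∂ n) M → ℝ) (β : CovectorField n M) :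
    TangentBundle (𝓡∂ n) M → ℝ :=
  fun v => F v + β v.1 v.2

/-- `F ^ 2` in the coordinates `(p, y)` of the chart centred at `a`. -/
def chartSq (F : TangentBundle (𝓡∂ n) M → ℝ) (a : M) (p y : EuclideanSpace ℝ (Fin n)) : ℝ :=
  F (tangentOfChart a p y) ^ 2

/-- The local metric `g_{ij} = (1/2) ∂²F²/∂y^i∂y^j` in the chart centred at `a`. -/
def localMetric (F : TangentBundle (𝓡∂ n) M → ℝ) (a : M) (p y : EuclideanSpace ℝ (Fin n)) :
    Matrix (Fin n) (Fin n) ℝ :=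
  Matrix.of fun i j => (1 / 2 : ℝ) *
    fderiv ℝ (fun v => fderiv ℝ (chartSq F a p) v (EuclideanSpace.single j 1)) y
      (EuclideanSpace.single i 1)

/-- The spray coefficients
`G^i = (1/4) g^{il} (y^k ∂²F²/∂x^k∂y^l - ∂F²/∂x^l)` in the chart centred at `a`. -/
def spray (F : TangentBundle (𝓡∂ n) M → ℝ) (a : M) (p y : EuclideanSpace ℝ (Fin n))
    (i : Fin n) : ℝ :=
  (1 / 4 : ℝ) * ∑ l, (localMetric F a p y)⁻¹ i l *
    ((∑ k, y k * fderivWithin ℝ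
        (fun q => fderiv ℝ (chartSq F a q) y (EuclideanSpace.single l 1))
        (Set.range (𝓡∂ n)) p (EuclideanSpace.single k 1))
      - fderivWithin ℝ (fun q => chartSq F a q y) (Set.range (𝓡∂ n)) p
          (EuclideanSpace.single l 1))

/-- The tangent vector `(γ(t), γ'(t))` of a curve on `[0, 1]` (one-sided at the end points). -/
def velocity (γ : ℝ → M) (t : ℝ) : TangentBundle (𝓡∂ n) M :=
  ⟨γ t, mfderivWithin 𝓘(ℝ, ℝ) (𝓡∂ n) γ (Set.Icc 0 1) t (1 : ℝ)⟩

/-- The length `L_F(γ)` of a curve on `[0, 1]`. -/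
def length (F : TangentBundle (𝓡∂ n) M → ℝ) (γ : ℝ → M) : ℝ :=
  ∫ t in (0 : ℝ)..1, F (velocity γ t)

/-- `γ` is a (nonconstant) geodesic of `F`, parametrized by `[0, 1]`: a smooth curve with nowhere
vanishing velocity which satisfies `u'' ^ i + 2 G^i(u, u') = 0` at every time and in every chart
around the current point, `u` being the coordinate expression of `γ`. Only the values of `γ` on
`[0, 1]` matter. -/
structure IsGeodesic (F : TangentBundle (𝓡∂ n) M → ℝ) (γ : ℝ → M) : Prop where
  smooth : ContMDiffOn 𝓘(ℝ, ℝ) (𝓡∂ n) ∞ γ (Set.Icc 0 1)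
  regular : ∀ t ∈ Set.Icc (0 : ℝ) 1, (velocity (n := n) γ t).2 ≠ 0
  equation : ∀ t ∈ Set.Icc (0 : ℝ) 1, ∀ a : M, γ t ∈ (extChartAt (𝓡∂ n) a).source → ∀ i : Fin n,
    derivWithin (derivWithin (fun s => extChartAt (𝓡∂ n) a (γ s)) (Set.Icc 0 1))
        (Set.Icc 0 1) t i
      + 2 * spray F a (extChartAt (𝓡∂ n) a (γ t))
          (derivWithin (fun s => extChartAt (𝓡∂ n) a (γ s)) (Set.Icc 0 1) t) i = 0

/-- `γ` is a geodesic of `F` going from `x` to `x'`. -/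
def IsGeodesicFromTo (F : TangentBundle (𝓡∂ n) M → ℝ) (x x' : M) (γ : ℝ → M) : Prop :=
  IsGeodesic F γ ∧ γ 0 = x ∧ γ 1 = x'

/-- `F` is admissible: any two (distinct) boundary points `x`, `x'` are joined by a unique geodesic
of `F` going from `x` to `x'`. Solutions of the geodesic equation are unique up to affine changes of
the parameter, which is why they are normalized to be defined on `[0, 1]`; a geodesic on a compact
interval has finite length. -/
def IsAdmissible (F : TangentBundle (𝓡∂ n) M → ℝ) : Prop :=
  ∀ x ∈ (𝓡∂ n).boundary M, ∀ x' ∈ (𝓡∂ n).boundary M, x ≠ x' →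
    ∃ γ : ℝ → M, IsGeodesicFromTo F x x' γ ∧
      ∀ γ' : ℝ → M, IsGeodesicFromTo F x x' γ' → Set.EqOn γ' γ (Set.Icc 0 1)

open Classical in
/-- The boundary distance data `d_F(x, x') = L_F(γ)` of an admissible `F`, where `γ` is the
geodesic from `x` to `x'`; for `x = x'` it is the constant curve, of length zero. -/
def boundaryDist (F : TangentBundle (𝓡∂ n) M → ℝ) (x x' : M) : ℝ :=
  if x = x' then 0
  else if h : ∃ γ : ℝ → M, IsGeodesicFromTo F x x' γ then length F h.choose else 0

end Finsler

end

/-! ### Lagrangians on a set of a normed space -/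

namespace Finsler

open Function Set Filter Topology

section Lagrangian

variable {E : Type*} [NormedAddCommGroup E] [NormedSpace ℝ E]

/-- The Euler–Lagrange expression `L_{yy}(a, w) + L_{xy}(y, w) - L_x(w)` of a Lagrangian `L` at
`(p, y)`, the derivatives in the base point being taken within `S`. -/
noncomputable def eulerLagrange (S : Set E) (L : E → E → ℝ) (p y a w : E) : ℝ :=
  fderiv ℝ (fun v => fderiv ℝ (L p) v w) y a + fderivWithin ℝ (fun q => fderiv ℝ (L q) y w) S p y
    - fderivWithin ℝ (fun q => L q y) S p w

/-- The Lagrangian `L` is jointly smooth at `(p, y)` within `S × E`, for all `y ≠ 0`. -/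
def SmoothOffZeroAt (S : Set E) (L : E → E → ℝ) (p : E) : Prop :=
  ∀ y ≠ 0, ContDiffWithinAt ℝ ∞ (uncurry L) (S ×ˢ univ) (p, y)

namespace SmoothOffZeroAt

variable {S : Set E} {L : E → E → ℝ} {p y : E}

theorem contDiffAt (h : SmoothOffZeroAt S L p) (hp : p ∈ S) (hy : y ≠ 0) :
    ContDiffAt ℝ ∞ (L p) y := by
  have : ContDiffWithinAt ℝ ∞ (fun v : E => (p, v)) univ y := by fun_prop
  exact contDiffWithinAt_univ.1 ((h y hy).comp y this fun v _ => ⟨hp, mem_univ _⟩)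

theorem differentiableAt (h : SmoothOffZeroAt S L p) (hp : p ∈ S) (hy : y ≠ 0) :
    DifferentiableAt ℝ (L p) y :=
  (h.contDiffAt hp hy).differentiableAt (by simp)

theorem differentiableAt_fderiv (h : SmoothOffZeroAt S L p) (hp : p ∈ S) (hy : y ≠ 0) :
    DifferentiableAt ℝ (fderiv ℝ (L p)) y :=
  ((h.contDiffAt hp hy).fderiv_right (m := 1) (by norm_cast)).differentiableAt (by simp)

theorem fderiv_fderiv_apply (h : SmoothOffZeroAt S L p) (hp : p ∈ S) (hy : y ≠ 0) (a w : E) :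
    fderiv ℝ (fun v => fderiv ℝ (L p) v w) y a = fderiv ℝ (fderiv ℝ (L p)) y a w := by
  rw [fderiv_clm_apply (h.differentiableAt_fderiv hp hy) (differentiableAt_const w)]
  simp

theorem fderiv_fderiv_comm (h : SmoothOffZeroAt S L p) (hp : p ∈ S) (hy : y ≠ 0) (a w : E) :
    fderiv ℝ (fun v => fderiv ℝ (L p) v w) y a = fderiv ℝ (fun v => fderiv ℝ (L p) v a) y w := by
  rw [h.fderiv_fderiv_apply hp hy, h.fderiv_fderiv_apply hp hy]
  exact (h.contDiffAt hp hy).isSymmSndFDerivAt (by simp; norm_cast) _ _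

theorem differentiableWithinAt (h : SmoothOffZeroAt S L p) (hy : y ≠ 0) :
    DifferentiableWithinAt ℝ (fun q => L q y) S p := by
  have : ContDiffWithinAt ℝ ∞ (fun q : E => (q, y)) S p := by fun_prop
  have h' : ContDiffWithinAt ℝ ∞ (fun q => L q y) S p :=
    ContDiffWithinAt.comp (t := S ×ˢ univ) (g := uncurry L) p (h y hy) this
      fun v hv => ⟨hv, mem_univ _⟩
  exact h'.differentiableWithinAt (by simp)

theorem differentiableWithinAt_fderiv (h : SmoothOffZeroAt S L p) (hp : p ∈ S) (hy : y ≠ 0)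
    (w : E) : DifferentiableWithinAt ℝ (fun q => fderiv ℝ (L q) y w) S p := by
  have : ContDiffWithinAt ℝ 1 (fun q => fderivWithin ℝ (L q) univ y) S p :=
    ContDiffWithinAt.fderivWithin (g := fun _ => y) (h y hy) contDiffWithinAt_const
      uniqueDiffOn_univ (by norm_cast) hp (by simp)
  simp only [fderivWithin_univ] at this
  exact (this.differentiableWithinAt (by simp)).clm_apply (differentiableWithinAt_const w)

theorem hasDerivWithinAt_comp (h : SmoothOffZeroAt S L p) (hp : p ∈ S) (hS : UniqueDiffWithinAt ℝ S p)
    (hy : y ≠ 0) {u v : ℝ → E} {u' v' : E} {J : Set ℝ} {t : ℝ} (hu : HasDerivWithinAt u u' J t)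
    (hv : HasDerivWithinAt v v' J t) (hup : u t = p) (hvy : v t = y)
    (hJ : ∀ᶠ s in 𝓝[J] t, u s ∈ S) :
    HasDerivWithinAt (fun s => L (u s) (v s))
      (fderivWithin ℝ (fun q => L q y) S p u' + fderiv ℝ (L p) y v') J t := by
  subst hup hvy
  have hD := ((h _ hy).differentiableWithinAt (by simp)).hasFDerivWithinAt
  set D := fderivWithin ℝ (uncurry L) (S ×ˢ univ) (u t, v t)
  have h1 : HasFDerivWithinAt (fun q => L q (v t)) (D.comp (ContinuousLinearMap.inl ℝ E E)) S (u t) :=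
    HasFDerivWithinAt.comp (t := S ×ˢ univ) (g := uncurry L) (f := fun q => (q, v t)) (u t) hD
      (hasFDerivAt_prodMk_left (𝕜 := ℝ) (u t) (v t)).hasFDerivWithinAt fun q hq => ⟨hq, mem_univ _⟩
  have h2 : HasFDerivAt (L (u t)) (D.comp (ContinuousLinearMap.inr ℝ E E)) (v t) := by
    rw [← hasFDerivWithinAt_univ]
    exact HasFDerivWithinAt.comp (t := S ×ˢ univ) (g := uncurry L) (f := fun q => (u t, q)) (v t) hD
      (hasFDerivAt_prodMk_right (𝕜 := ℝ) (u t) (v t)).hasFDerivWithinAt fun q hq => ⟨hp, mem_univ _⟩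
  rw [h1.fderivWithin hS, h2.fderiv]
  have h3 : HasDerivWithinAt (fun s => L (u s) (v s)) (D (u', v')) (J ∩ {s | u s ∈ S}) t :=
    HasFDerivWithinAt.comp_hasDerivWithinAt (t := S ×ˢ univ) (l := uncurry L)
      (f := fun s => (u s, v s)) t hD ((hu.prodMk hv).mono inter_subset_left) fun s hs => ⟨hs.2, mem_univ _⟩
  have e : D.comp (ContinuousLinearMap.inl ℝ E E) u' + D.comp (ContinuousLinearMap.inr ℝ E E) v'
      = D (u', v') := by
    rw [ContinuousLinearMap.comp_apply, ContinuousLinearMap.comp_apply, ← map_add]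
    simp
  rw [e]
  exact h3.mono_of_mem_nhdsWithin (inter_mem self_mem_nhdsWithin hJ)

end SmoothOffZeroAt

theorem eulerLagrange_add {S : Set E} {L : E → E → ℝ} {b : E → E →L[ℝ] ℝ} {p y : E}
    (h : SmoothOffZeroAt S L p) (hn : ∀ᶠ q in 𝓝[S] p, SmoothOffZeroAt S L q) (hp : p ∈ S)
    (hS : UniqueDiffWithinAt ℝ S p) (hy : y ≠ 0)
    (hb : ∀ w, DifferentiableWithinAt ℝ (fun q => b q w) S p)
    (hclosed : ∀ v w, fderivWithin ℝ (fun q => b q w) S p v = fderivWithin ℝ (fun q => b q v) S p w)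
    (a w : E) :
    eulerLagrange S (fun q v => L q v + b q v) p y a w = eulerLagrange S L p y a w := by
  have key : ∀ q ∈ S, SmoothOffZeroAt S L q → ∀ v ≠ 0,
      fderiv ℝ (fun v => L q v + b q v) v w = fderiv ℝ (L q) v w + b q w := by
    intro q hq hLq v hv
    rw [fderiv_fun_add (hLq.differentiableAt hq hv) (b q).differentiableAt]
    simp
  have h1 : fderiv ℝ (fun v => fderiv ℝ (fun v => L p v + b p v) v w) y a
      = fderiv ℝ (fun v => fderiv ℝ (L p) v w) y a := by
    have : (fun v => fderiv ℝ (fun v => L p v + b p v) v w) =ᶠ[𝓝 y]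
        fun v => fderiv ℝ (L p) v w + b p w := by
      filter_upwards [isOpen_ne.mem_nhds hy] with v hv using key p hp h v hv
    rw [this.fderiv_eq, fderiv_add_const]
  have h2 : fderivWithin ℝ (fun q => fderiv ℝ (fun v => L q v + b q v) y w) S p y
      = fderivWithin ℝ (fun q => fderiv ℝ (L q) y w) S p y
        + fderivWithin ℝ (fun q => b q w) S p y := by
    have : (fun q => fderiv ℝ (fun v => L q v + b q v) y w) =ᶠ[𝓝[S] p]
        fun q => fderiv ℝ (L q) y w + b q w := by
      filter_upwards [hn, self_mem_nhdsWithin] with q hq hqS using key q hqS hq y hy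
    rw [this.fderivWithin_eq (key p hp h y hy),
      fderivWithin_fun_add hS (h.differentiableWithinAt_fderiv hp hy w) (hb w)]
    simp
  have h3 : fderivWithin ℝ (fun q => L q y + b q y) S p w
      = fderivWithin ℝ (fun q => L q y) S p w + fderivWithin ℝ (fun q => b q y) S p w := by
    rw [fderivWithin_fun_add hS (h.differentiableWithinAt hy) (hb y)]
    simp
  rw [eulerLagrange, h1, h2, h3, hclosed y w, eulerLagrange]
  ring

theorem fderiv_sq_apply {f : E → ℝ} {v : E} (hf : DifferentiableAt ℝ f v) (w : E) :
    fderiv ℝ (fun v => f v ^ 2) v w = 2 * (f v * fderiv ℝ f v w) := by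
  rw [fderiv_fun_pow 2 hf]
  simp
  ring

theorem fderiv_fderiv_sq {f : E → ℝ} {y : E} (hf : ContDiffAt ℝ ∞ f y) (a w : E) :
    fderiv ℝ (fun v => fderiv ℝ (fun v' => f v' ^ 2) v w) y a =
      2 * (fderiv ℝ f y a * fderiv ℝ f y w + f y * fderiv ℝ (fun v => fderiv ℝ f v w) y a) := by
  have h1 : ∀ᶠ v in 𝓝 y, DifferentiableAt ℝ f v := by
    filter_upwards [(hf.of_le (m := 1) (by norm_cast)).eventually (by simp)] with v hv
      using hv.differentiableAt (by simp)
  have h2 : DifferentiableAt ℝ (fun v => fderiv ℝ f v w) y :=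
    ((hf.fderiv_right (m := 1) (by norm_cast)).differentiableAt (by simp)).clm_apply
      (differentiableAt_const w)
  have h3 : (fun v => fderiv ℝ (fun v' => f v' ^ 2) v w) =ᶠ[𝓝 y]
      fun v => 2 * (f v * fderiv ℝ f v w) := by
    filter_upwards [h1] with v hv using fderiv_sq_apply hv w
  have h0 := hf.differentiableAt (by simp)
  rw [h3.fderiv_eq, fderiv_const_mul (h0.fun_mul h2), fderiv_fun_mul h0 h2]
  simp
  ring

theorem eulerLagrange_sq {S : Set E} {L : E → E → ℝ} {p y : E} (h : SmoothOffZeroAt S L p)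
    (hn : ∀ᶠ q in 𝓝[S] p, SmoothOffZeroAt S L q) (hp : p ∈ S)
    (hS : UniqueDiffWithinAt ℝ S p) (hy : y ≠ 0) (a w : E) :
    eulerLagrange S (fun q v => L q v ^ 2) p y a w =
      2 * (L p y * eulerLagrange S L p y a w + fderiv ℝ (L p) y w *
        (fderivWithin ℝ (fun q => L q y) S p y + fderiv ℝ (L p) y a)) := by
  have h2 : fderivWithin ℝ (fun q => fderiv ℝ (fun v => L q v ^ 2) y w) S p y =
      2 * (fderivWithin ℝ (fun q => L q y) S p y * fderiv ℝ (L p) y w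
        + L p y * fderivWithin ℝ (fun q => fderiv ℝ (L q) y w) S p y) := by
    have : (fun q => fderiv ℝ (fun v => L q v ^ 2) y w) =ᶠ[𝓝[S] p]
        fun q => 2 * (L q y * fderiv ℝ (L q) y w) := by
      filter_upwards [hn, self_mem_nhdsWithin] with q hq hqS
        using fderiv_sq_apply (hq.differentiableAt hqS hy) w
    have d1 := h.differentiableWithinAt hy
    have d2 := h.differentiableWithinAt_fderiv hp hy w
    rw [this.fderivWithin_eq (fderiv_sq_apply (h.differentiableAt hp hy) w),
      fderivWithin_const_mul hS (d1.fun_mul d2), fderivWithin_fun_mul hS d1 d2]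
    simp
    ring
  have h3 : fderivWithin ℝ (fun q => L q y ^ 2) S p w =
      2 * (L p y * fderivWithin ℝ (fun q => L q y) S p w) := by
    rw [fderivWithin_fun_pow hS 2 (h.differentiableWithinAt hy)]
    simp
    ring
  rw [eulerLagrange, h2, h3, eulerLagrange, fderiv_fderiv_sq (h.contDiffAt hp hy)]
  ring

/-! ### Positively homogeneous functions -/

/-- Euler's identity. -/
theorem fderiv_self_of_homogeneous {f : E → ℝ} (hf : ∀ v (c : ℝ), 0 ≤ c → f (c • v) = c * f v)
    {y : E} (hd : DifferentiableAt ℝ f y) : fderiv ℝ f y y = f y := by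
  have h1 : HasDerivAt (fun c : ℝ => f (c • y)) (fderiv ℝ f y y) 1 := by
    have hd' : HasFDerivAt f (fderiv ℝ f y) ((1 : ℝ) • y) := by simpa using hd.hasFDerivAt
    simpa [comp_def] using hd'.comp_hasDerivAt (1 : ℝ) ((hasDerivAt_id (1 : ℝ)).smul_const y)
  have h2 : HasDerivAt (fun c : ℝ => f (c • y)) (f y) 1 := by
    have : (fun c : ℝ => f (c • y)) =ᶠ[𝓝 1] fun c => c * f y := by
      filter_upwards [lt_mem_nhds (zero_lt_one' ℝ)] with c hc using hf y c hc.le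
    refine HasDerivAt.congr_of_eventuallyEq ?_ this
    simpa using (hasDerivAt_id (1 : ℝ)).mul_const (f y)
  exact h1.unique h2

theorem fderiv_fderiv_self_of_homogeneous {f : E → ℝ}
    (hf : ∀ v (c : ℝ), 0 ≤ c → f (c • v) = c * f v) {y : E} (hd : ContDiffAt ℝ ∞ f y) (a : E) :
    fderiv ℝ (fun v => fderiv ℝ f v y) y a = 0 := by
  have h1 : (fun v => fderiv ℝ f v v) =ᶠ[𝓝 y] f := by
    filter_upwards [(hd.of_le (m := 1) (by norm_cast)).eventually (by simp)] with v hv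
      using fderiv_self_of_homogeneous hf (hv.differentiableAt (by simp))
  have h2 := (hd.fderiv_right (m := 1) (by norm_cast)).differentiableAt (by simp)
  have h3 := congrArg (fun l => l a) (h1.fderiv_eq (𝕜 := ℝ))
  rw [fderiv_clm_apply h2 differentiableAt_fun_id] at h3
  rw [fderiv_clm_apply h2 (differentiableAt_const y)]
  simpa using h3

theorem eulerLagrange_self {S : Set E} {L : E → E → ℝ} {p y : E} (h : SmoothOffZeroAt S L p)
    (hn : ∀ᶠ q in 𝓝[S] p, SmoothOffZeroAt S L q) (hp : p ∈ S) (hy : y ≠ 0)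
    (hom : ∀ q v (c : ℝ), 0 ≤ c → L q (c • v) = c * L q v) (a : E) :
    eulerLagrange S L p y a y = 0 := by
  have h1 : (fun q => fderiv ℝ (L q) y y) =ᶠ[𝓝[S] p] fun q => L q y := by
    filter_upwards [hn, self_mem_nhdsWithin] with q hq hqS
      using fderiv_self_of_homogeneous (hom q) (hq.differentiableAt hqS hy)
  rw [eulerLagrange, fderiv_fderiv_self_of_homogeneous (hom p) (h.contDiffAt hp hy),
    h1.fderivWithin_eq (fderiv_self_of_homogeneous (hom p) (h.differentiableAt hp hy))]
  ring

theorem eulerLagrange_eq_zero_of_sq {S : Set E} {L : E → E → ℝ} {p y : E}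
    (h : SmoothOffZeroAt S L p)
    (hn : ∀ᶠ q in 𝓝[S] p, SmoothOffZeroAt S L q) (hp : p ∈ S)
    (hS : UniqueDiffWithinAt ℝ S p) (hy : y ≠ 0)
    (hom : ∀ q v (c : ℝ), 0 ≤ c → L q (c • v) = c * L q v) (hpos : 0 < L p y) {a : E}
    (hE : ∀ w, eulerLagrange S (fun q v => L q v ^ 2) p y a w = 0) (w : E) :
    eulerLagrange S L p y a w = 0 := by
  have h1 := hE y
  have h2 := hE w
  rw [eulerLagrange_sq h hn hp hS hy] at h1 h2
  rw [eulerLagrange_self h hn hp hy hom,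
    fderiv_self_of_homogeneous (hom p) (h.differentiableAt hp hy)] at h1
  have h3 : fderivWithin ℝ (fun q => L q y) S p y + fderiv ℝ (L p) y a = 0 := by
    have : L p y * (fderivWithin ℝ (fun q => L q y) S p y + fderiv ℝ (L p) y a) = 0 := by linarith
    exact (mul_eq_zero.1 this).resolve_left hpos.ne'
  rw [h3] at h2
  have : L p y * eulerLagrange S L p y a w = 0 := by linarith
  exact (mul_eq_zero.1 this).resolve_left hpos.ne'

theorem fderiv_smul_of_abs_homogeneous {f : E → ℝ} (hf : ∀ v (c : ℝ), f (c • v) = |c| * f v)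
    {c : ℝ} (hc : c ≠ 0) (v : E) : fderiv ℝ f (c • v) = (|c| * c⁻¹) • fderiv ℝ f v := by
  have h1 : (fun v => f (c • v)) = |c| • f := by
    ext v; simp [hf]
  have h2 := fderiv_comp_smul (𝕜 := ℝ) (f := f) (x := v) c
  rw [h1, fderiv_const_smul_field, Pi.smul_apply] at h2
  rw [mul_comm, mul_smul, h2, smul_smul, inv_mul_cancel₀ hc, one_smul]

theorem eulerLagrange_smul {S : Set E} {L : E → E → ℝ} {p y : E} (h : SmoothOffZeroAt S L p)
    (hp : p ∈ S) (hS : UniqueDiffWithinAt ℝ S p) (hy : y ≠ 0)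
    (hom : ∀ q v (c : ℝ), L q (c • v) = |c| * L q v) {c : ℝ} (hc : c ≠ 0) (d : ℝ) (a w : E) :
    eulerLagrange S L p (c • y) (c ^ 2 • a + d • y) w = |c| * eulerLagrange S L p y a w := by
  have hcy : c • y ≠ 0 := smul_ne_zero hc hy
  have h1 : fderiv ℝ (fun v => fderiv ℝ (L p) v w) (c • y) =
      (|c| * c⁻¹ * c⁻¹) • fderiv ℝ (fun v => fderiv ℝ (L p) v w) y := by
    have e := fderiv_comp_smul (𝕜 := ℝ) (f := fun v => fderiv ℝ (L p) v w) (x := y) c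
    have e' : (fun v => fderiv ℝ (L p) (c • v) w) =
        (|c| * c⁻¹) • fun v => fderiv ℝ (L p) v w := by
      ext v
      rw [fderiv_smul_of_abs_homogeneous (hom p) hc]
      rfl
    rw [e', fderiv_const_smul_field, Pi.smul_apply] at e
    rw [mul_comm, mul_smul, e, smul_smul, inv_mul_cancel₀ hc, one_smul]
  have h2 : fderivWithin ℝ (fun q => fderiv ℝ (L q) (c • y) w) S p =
      (|c| * c⁻¹) • fderivWithin ℝ (fun q => fderiv ℝ (L q) y w) S p := by
    rw [← fderivWithin_const_smul_field _ hS]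
    congr 1
    ext q
    rw [fderiv_smul_of_abs_homogeneous (hom q) hc]
    rfl
  have h3 : fderivWithin ℝ (fun q => L q (c • y)) S p =
      |c| • fderivWithin ℝ (fun q => L q y) S p := by
    rw [← fderivWithin_const_smul_field _ hS]
    congr 1
    ext q
    simp [hom]
  have h4 : fderiv ℝ (fun v => fderiv ℝ (L p) v w) y y = 0 := by
    rw [h.fderiv_fderiv_comm hp hy]
    exact fderiv_fderiv_self_of_homogeneous
      (fun v c hc => by rw [hom, abs_of_nonneg hc]) (h.contDiffAt hp hy) w
  rw [eulerLagrange, h1, h2, h3, eulerLagrange]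
  simp only [map_add, map_smul, smul_apply, h4, smul_eq_mul]
  field_simp
  ring

/-- Adding a linear form to a strictly convex Minkowski norm keeps the Hessian of the square
nondegenerate. -/
theorem hessian_sq_add_nondegenerate {f : E → ℝ} (hf : ∀ v ≠ 0, ContDiffAt ℝ ∞ f v)
    (hom : ∀ v (c : ℝ), 0 ≤ c → f (c • v) = c * f v) (hpos : ∀ v ≠ 0, 0 < f v)
    (hconv : ∀ y w, y ≠ 0 → w ≠ 0 →
      0 < fderiv ℝ (fun v => fderiv ℝ (fun v' => f v' ^ 2) v w) y w)
    (b : E →L[ℝ] ℝ) (hb : ∀ v ≠ 0, 0 < f v + b v) {y w : E} (hy : y ≠ 0)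
    (hw : fderiv ℝ (fun v => fderiv ℝ (fun v' => (f v' + b v') ^ 2) v w) y w = 0) : w = 0 := by
  by_contra hw0
  have hfb : ContDiffAt ℝ ∞ (fun v => f v + b v) y := (hf y hy).add b.contDiff.contDiffAt
  have hd : ∀ v ≠ 0, DifferentiableAt ℝ f v := fun v hv => (hf v hv).differentiableAt (by simp)
  have hD2 : DifferentiableAt ℝ (fderiv ℝ f) y :=
    ((hf y hy).fderiv_right (m := 1) (by norm_cast)).differentiableAt (by simp)
  have hB : ∀ a z, fderiv ℝ (fun v => fderiv ℝ f v z) y a = fderiv ℝ (fderiv ℝ f) y a z := by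
    intro a z
    rw [fderiv_clm_apply hD2 (differentiableAt_const z)]
    simp
  have hsymm : ∀ a z, fderiv ℝ (fderiv ℝ f) y a z = fderiv ℝ (fderiv ℝ f) y z a :=
    fun a z => (hf y hy).isSymmSndFDerivAt (by simp; norm_cast) a z
  have hy0 : ∀ a, fderiv ℝ (fderiv ℝ f) y a y = 0 := fun a => by
    rw [← hB]
    exact fderiv_fderiv_self_of_homogeneous hom (hf y hy) a
  have hEuler := fderiv_self_of_homogeneous hom (hd y hy)
  have hsum : ∀ z, fderiv ℝ (fun v => fderiv ℝ (fun v => f v + b v) v z) y z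
      = fderiv ℝ (fderiv ℝ f) y z z := by
    intro z
    have : (fun v => fderiv ℝ (fun v => f v + b v) v z) =ᶠ[𝓝 y]
        fun v => fderiv ℝ f v z + b z := by
      filter_upwards [isOpen_ne.mem_nhds hy] with v hv
      rw [fderiv_fun_add (hd v hv) b.differentiableAt]
      simp
    rw [this.fderiv_eq, fderiv_add_const, hB]
  set c : ℝ := fderiv ℝ f y w / f y
  have hfy := hpos y hy
  -- `w = c y + z` with `z` in the kernel of the differential of `f` at `y`
  have hz : fderiv ℝ f y (w - c • y) = 0 := by
    rw [map_sub, map_smul, hEuler, smul_eq_mul, div_mul_cancel₀ _ hfy.ne', sub_self]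
  have hBz : fderiv ℝ (fderiv ℝ f) y w w =
      fderiv ℝ (fderiv ℝ f) y (w - c • y) (w - c • y) := by
    simp only [map_sub, map_smul, sub_apply, smul_apply,
      hy0, hsymm y w, smul_eq_mul]
    ring
  have hexp := fderiv_fderiv_sq hfb w w
  rw [hw, hsum, fderiv_fun_add (hd y hy) b.differentiableAt, hBz] at hexp
  simp only [add_apply, ContinuousLinearMap.fderiv] at hexp
  by_cases hz0 : w - c • y = 0
  · have hwc : w = c • y := sub_eq_zero.1 hz0
    have h1 : fderiv ℝ f y w + b w = c * (f y + b y) := by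
      rw [hwc, map_smul, map_smul, hEuler, smul_eq_mul, smul_eq_mul]
      ring
    rw [hz0, h1] at hexp
    have hc : c ≠ 0 := by
      rintro h
      exact hw0 (by rw [hwc, h, zero_smul])
    have := mul_pos (pow_pos (hb y hy) 2) (sq_pos_of_ne_zero hc)
    simp only [map_zero, mul_zero, add_zero] at hexp
    nlinarith
  · have h1 := hconv y (w - c • y) hy hz0
    rw [fderiv_fderiv_sq (hf y hy), hB, hz] at h1
    have h2 : 0 < f y * fderiv ℝ (fderiv ℝ f) y (w - c • y) (w - c • y) := by linarith
    have h3 := mul_pos (hb y hy) (pos_of_mul_pos_right h2 hfy.le)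
    nlinarith [mul_self_nonneg (fderiv ℝ f y w + b w)]

end Lagrangian

end Finsler

/-! ### Finsler functions in charts -/

namespace Finsler

open Function Set Filter Topology

section Chart

variable {n : ℕ} [NeZero n] {M : Type*} [TopologicalSpace M]
  [ChartedSpace (EuclideanHalfSpace n) M]

/-- A function on the tangent bundle in the coordinates of the chart centred at `a`. -/
noncomputable def chartLagrangian (F : TangentBundle (𝓡∂ n) M → ℝ) (a : M)
    (p y : EuclideanSpace ℝ (Fin n)) : ℝ :=
  F (tangentOfChart a p y)

theorem chartLagrangian_smul {F : TangentBundle (𝓡∂ n) M → ℝ} {c r : ℝ}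
    (hF : ∀ (x : M) (y : TangentSpace (𝓡∂ n) x), F ⟨x, c • y⟩ = r * F ⟨x, y⟩)
    (a : M) (p y : EuclideanSpace ℝ (Fin n)) :
    chartLagrangian F a p (c • y) = r * chartLagrangian F a p y := by
  simp only [chartLagrangian, tangentOfChart]
  rw [← hF]
  congr 2
  exact map_smul _ c y

theorem IsFinslerNorm.abs_homogeneous [IsManifold (𝓡∂ n) ∞ M] {F : TangentBundle (𝓡∂ n) M → ℝ}
    (hF : IsFinslerNorm F) (hrev : IsReversible F) (c : ℝ) (x : M) (y : TangentSpace (𝓡∂ n) x) :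
    F ⟨x, c • y⟩ = |c| * F ⟨x, y⟩ := by
  rcases le_total 0 c with hc | hc
  · rw [hF.homogeneous x y c hc, abs_of_nonneg hc]
  · rw [← hrev, ← neg_smul, hF.homogeneous x y (-c) (by linarith), abs_of_nonpos hc]

theorem uniqueDiffWithinAt_range_of_mem_target (a : M) {p : EuclideanSpace ℝ (Fin n)}
    (hp : p ∈ (extChartAt (𝓡∂ n) a).target) : UniqueDiffWithinAt ℝ (range (𝓡∂ n)) p :=
  (𝓡∂ n).uniqueDiffOn p (extChartAt_target_subset_range a hp)

/-- The spray of a nondegenerate Lagrangian is governed by its Euler–Lagrange expression. -/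
theorem add_spray_eq_zero_iff {F : TangentBundle (𝓡∂ n) M → ℝ} {a : M}
    {p y : EuclideanSpace ℝ (Fin n)} (hp : p ∈ range (𝓡∂ n)) (hy : y ≠ 0)
    (hF : SmoothOffZeroAt (range (𝓡∂ n)) (chartSq F a) p)
    (hdet : ∀ w, fderiv ℝ (fun v => fderiv ℝ (chartSq F a p) v w) y w = 0 → w = 0)
    (b : EuclideanSpace ℝ (Fin n)) :
    (∀ i, b i + 2 * spray F a p y i = 0) ↔
      ∀ w, eulerLagrange (range (𝓡∂ n)) (chartSq F a) p y b w = 0 := by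
  set D := fderiv ℝ (fderiv ℝ (chartSq F a p)) y
  have hD : ∀ u w, fderiv ℝ (fun v => fderiv ℝ (chartSq F a p) v w) y u = D u w :=
    fun u w => hF.fderiv_fderiv_apply hp hy u w
  have hsymm : ∀ u w, D u w = D w u := fun u w => by
    rw [← hD, ← hD, hF.fderiv_fderiv_comm hp hy]
  have hsum : ∀ u : EuclideanSpace ℝ (Fin n), ∑ i, u i • EuclideanSpace.single i (1 : ℝ) = u := by
    intro u
    ext j
    simp [Pi.single_apply]
  set g := localMetric F a p y
  have hg : ∀ i j, g i j = (1 / 2) * D (EuclideanSpace.single i 1) (EuclideanSpace.single j 1) := by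
    intro i j
    rw [← hD]
    rfl
  have hmul : ∀ (u : EuclideanSpace ℝ (Fin n)) j, (g.mulVec u) j
      = (1 / 2) * D u (EuclideanSpace.single j 1) := by
    intro u j
    conv_rhs => rw [hsymm, ← hsum u]
    simp only [Matrix.mulVec, dotProduct, hg, map_sum, map_smul, smul_eq_mul, Finset.mul_sum]
    exact Finset.sum_congr rfl fun i _ => by ring
  have hinj : Injective g.mulVec := by
    refine (injective_iff_map_eq_zero g.mulVecLin).2 fun u hu => ?_
    have h0 : ∀ j, D (WithLp.toLp 2 u) (EuclideanSpace.single j 1) = 0 := by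
      intro j
      have h1 := hmul (WithLp.toLp 2 u) j
      have h2 : (g.mulVec u) j = 0 := congrFun hu j
      rw [h2] at h1
      linarith
    have h3 : D (WithLp.toLp 2 u) (WithLp.toLp 2 u) = 0 := by
      conv_lhs =>
        arg 2
        rw [← hsum (WithLp.toLp 2 u)]
      simp [h0]
    have h4 := hdet (WithLp.toLp 2 u) (by rw [hD, h3])
    ext i
    exact congrArg (fun z : EuclideanSpace ℝ (Fin n) => z i) h4
  have hunit : IsUnit g := Matrix.mulVec_injective_iff_isUnit.1 hinj
  have hgg : g * g⁻¹ = 1 := Matrix.mul_nonsing_inv g ((Matrix.isUnit_iff_isUnit_det _).1 hunit)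
  have hgg' : g⁻¹ * g = 1 := Matrix.nonsing_inv_mul g ((Matrix.isUnit_iff_isUnit_det _).1 hunit)
  set B : EuclideanSpace ℝ (Fin n) → ℝ := fun w =>
    fderivWithin ℝ (fun q => fderiv ℝ (chartSq F a q) y w) (range (𝓡∂ n)) p y
      - fderivWithin ℝ (fun q => chartSq F a q y) (range (𝓡∂ n)) p w
  set Bv : Fin n → ℝ := fun l => B (EuclideanSpace.single l 1)
  have hspray : ∀ i, spray F a p y i = (1 / 4) * (g⁻¹.mulVec Bv) i := by
    intro i
    simp only [spray, Matrix.mulVec, dotProduct, Bv, B]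
    congr 1
    refine Finset.sum_congr rfl fun l _ => ?_
    congr 2
    conv_rhs => rw [← hsum y]
    rw [map_sum]
    simp [hsum]
  have hE : ∀ w, eulerLagrange (range (𝓡∂ n)) (chartSq F a) p y b w = D b w + B w := by
    intro w
    rw [eulerLagrange, hD]
    ring
  have hBadd : ∀ w, B w = ∑ l, w l * Bv l := by
    have hlin : ∀ w, fderivWithin ℝ (fun q => fderiv ℝ (chartSq F a q) y w) (range (𝓡∂ n)) p y
        = ∑ l, w l * fderivWithin ℝ (fun q => fderiv ℝ (chartSq F a q) y
          (EuclideanSpace.single l 1)) (range (𝓡∂ n)) p y := by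
      intro w
      have hU : UniqueDiffWithinAt ℝ (range (𝓡∂ n)) p := (𝓡∂ n).uniqueDiffOn p hp
      have h1 : (fun q => fderiv ℝ (chartSq F a q) y w) = fun q => ∑ l, w l •
          fderiv ℝ (chartSq F a q) y (EuclideanSpace.single l 1) := by
        ext q
        conv_lhs => rw [← hsum w]
        simp only [map_sum, map_smul]
      rw [h1, fderivWithin_fun_sum hU fun l _ =>
        (hF.differentiableWithinAt_fderiv hp hy _).fun_const_smul (w l), sum_apply]
      refine Finset.sum_congr rfl fun l _ => ?_
      rw [fderivWithin_fun_const_smul hU (hF.differentiableWithinAt_fderiv hp hy _)]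
      rfl
    intro w
    simp only [B, Bv, hlin w, mul_sub, Finset.sum_sub_distrib]
    congr 1
    conv_lhs => rw [← hsum w]
    simp only [map_sum, map_smul, smul_eq_mul]
  have hDb : ∀ w : EuclideanSpace ℝ (Fin n), D b w = ∑ l, w l * (2 * g.mulVec b l) := by
    intro w
    conv_lhs => rw [← hsum w]
    simp only [map_sum, map_smul, smul_eq_mul, hmul]
    exact Finset.sum_congr rfl fun i _ => by ring
  constructor
  · intro h w
    have hb : (b : Fin n → ℝ) = -((1 / 2 : ℝ) • g⁻¹.mulVec Bv) := by
      ext i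
      have := h i
      rw [hspray] at this
      simp only [Pi.neg_apply, Pi.smul_apply, smul_eq_mul]
      linarith
    have h2 : ∀ l, 2 * g.mulVec b l = - Bv l := by
      intro l
      rw [hb, Matrix.mulVec_neg, Matrix.mulVec_smul, Matrix.mulVec_mulVec, hgg, Matrix.one_mulVec]
      simp
    rw [hE, hDb, hBadd]
    simp [h2]
  · intro h i
    have h1 : g.mulVec b = -((1 / 2 : ℝ) • Bv) := by
      ext l
      have := h (EuclideanSpace.single l 1)
      rw [hE] at this
      have h2 := hmul b l
      simp only [Pi.neg_apply, Pi.smul_apply, smul_eq_mul]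
      rw [h2]
      linarith
    have h2 := congrArg (g⁻¹.mulVec) h1
    rw [Matrix.mulVec_mulVec, hgg', Matrix.one_mulVec, Matrix.mulVec_neg, Matrix.mulVec_smul] at h2
    have h3 := congrFun h2 i
    simp only [Pi.neg_apply, Pi.smul_apply, smul_eq_mul] at h3
    rw [hspray, h3]
    ring

variable [IsManifold (𝓡∂ n) ∞ M]

theorem IsFinslerNorm.pos {F : TangentBundle (𝓡∂ n) M → ℝ} (hF : IsFinslerNorm F)
    {v : TangentBundle (𝓡∂ n) M} (hv : v.2 ≠ 0) : 0 < F v :=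
  (hF.nonneg v).lt_of_ne fun h => hv ((hF.eq_zero_iff v.1 v.2).1 h.symm)

/-- The derivative of the inverse chart at `p`, as a linear automorphism of the coordinates. -/
theorem exists_tangentOfChart_eq (a : M) {p : EuclideanSpace ℝ (Fin n)}
    (hp : p ∈ (extChartAt (𝓡∂ n) a).target) :
    ∃ A : EuclideanSpace ℝ (Fin n) ≃L[ℝ] EuclideanSpace ℝ (Fin n),
      ∀ y, tangentOfChart a p y = ⟨(extChartAt (𝓡∂ n) a).symm p, A y⟩ := by
  obtain ⟨A, hA⟩ := isInvertible_mfderivWithin_extChartAt_symm (I := 𝓡∂ n) hp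
  refine ⟨A, fun y => ?_⟩
  rw [tangentOfChart, ← hA]
  rfl

theorem contMDiffOn_tangentOfChart (a : M) :
    ContMDiffOn 𝓘(ℝ, EuclideanSpace ℝ (Fin n) × EuclideanSpace ℝ (Fin n)) (𝓡∂ n).tangent ∞
      (fun z : EuclideanSpace ℝ (Fin n) × EuclideanSpace ℝ (Fin n) => tangentOfChart a z.1 z.2)
      ((extChartAt (𝓡∂ n) a).target ×ˢ univ) := by
  let e := trivializationAt (EuclideanSpace ℝ (Fin n)) (TangentSpace (𝓡∂ n) (M := M)) a
  have he := e.contMDiffOn_symm (IB := 𝓡∂ n) (n := ∞)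
  have h1 : ContMDiffOn 𝓘(ℝ, EuclideanSpace ℝ (Fin n) × EuclideanSpace ℝ (Fin n))
      ((𝓡∂ n).prod 𝓘(ℝ, EuclideanSpace ℝ (Fin n))) ∞
      (fun z : EuclideanSpace ℝ (Fin n) × EuclideanSpace ℝ (Fin n) =>
        ((extChartAt (𝓡∂ n) a).symm z.1, z.2))
      ((extChartAt (𝓡∂ n) a).target ×ˢ univ) := by
    refine ContMDiffOn.prodMk ?_ ?_
    · exact (contMDiffOn_extChartAt_symm a).comp contDiff_fst.contMDiff.contMDiffOn
        fun z hz => hz.1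
    · exact contDiff_snd.contMDiff.contMDiffOn
  refine (he.comp h1 fun z hz => ?_).congr fun z hz => ?_
  · rw [mem_preimage, e.mem_target]
    simpa [e] using (extChartAt (𝓡∂ n) a).map_target hz.1
  · have hx := (extChartAt (𝓡∂ n) a).map_target hz.1
    rw [extChartAt_source] at hx
    have h2 := TangentBundle.symmL_trivializationAt (I := 𝓡∂ n) hx
    rw [(extChartAt (𝓡∂ n) a).right_inv hz.1] at h2
    rw [tangentOfChart, ← h2]
    have hx' : (extChartAt (𝓡∂ n) a).symm z.1 ∈ e.baseSet := by simpa [e] using hx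
    refine Eq.trans ?_ (e.mk_symm hx' z.2)
    exact congrArg (Bundle.TotalSpace.mk' _ _) (e.symmL_apply (R := ℝ) hx' z.2)

theorem IsFinslerNorm.smoothOffZeroAt {F : TangentBundle (𝓡∂ n) M → ℝ} (hF : IsFinslerNorm F)
    (a : M) {p : EuclideanSpace ℝ (Fin n)} (hp : p ∈ (extChartAt (𝓡∂ n) a).target) :
    SmoothOffZeroAt (range (𝓡∂ n)) (chartLagrangian F a) p := by
  intro y hy
  have h1 := ((contMDiffOn_tangentOfChart a) (p, y) ⟨hp, mem_univ _⟩)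
  have hy' : (tangentOfChart a p y).2 ≠ 0 := by
    obtain ⟨A, hA⟩ := exists_tangentOfChart_eq a hp
    rw [hA]
    exact (map_ne_zero_iff A A.injective).2 hy
  have h2 := hF.smooth (tangentOfChart a p y) hy'
  have h3 : ContMDiffWithinAt 𝓘(ℝ, EuclideanSpace ℝ (Fin n) × EuclideanSpace ℝ (Fin n)) 𝓘(ℝ, ℝ) ∞
      (uncurry (chartLagrangian F a)) ((extChartAt (𝓡∂ n) a).target ×ˢ {0}ᶜ) (p, y) := by
    refine ContMDiffWithinAt.comp (p, y) h2 (h1.mono (by gcongr; simp)) ?_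
    rintro ⟨q, v⟩ ⟨hq, hv⟩
    obtain ⟨A, hA⟩ := exists_tangentOfChart_eq a hq
    change (tangentOfChart a q v).2 ≠ 0
    rw [hA]
    exact (map_ne_zero_iff A A.injective).2 hv
  refine h3.contDiffWithinAt.mono_of_mem_nhdsWithin ?_
  rw [nhdsWithin_prod_eq]
  exact prod_mem_prod (extChartAt_target_mem_nhdsWithin_of_mem hp)
    (by rw [nhdsWithin_univ]; exact isOpen_ne.mem_nhds hy)

theorem IsFinslerNorm.eventually_smoothOffZeroAt {F : TangentBundle (𝓡∂ n) M → ℝ}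
    (hF : IsFinslerNorm F) (a : M) {p : EuclideanSpace ℝ (Fin n)}
    (hp : p ∈ (extChartAt (𝓡∂ n) a).target) :
    ∀ᶠ q in 𝓝[range (𝓡∂ n)] p, SmoothOffZeroAt (range (𝓡∂ n)) (chartLagrangian F a) q := by
  filter_upwards [extChartAt_target_mem_nhdsWithin_of_mem hp] with q hq
    using hF.smoothOffZeroAt a hq

theorem IsFinslerNorm.chart_pos {F : TangentBundle (𝓡∂ n) M → ℝ} (hF : IsFinslerNorm F)
    (a : M) {p y : EuclideanSpace ℝ (Fin n)} (hp : p ∈ (extChartAt (𝓡∂ n) a).target)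
    (hy : y ≠ 0) : 0 < chartLagrangian F a p y := by
  obtain ⟨A, hA⟩ := exists_tangentOfChart_eq a hp
  refine hF.pos ?_
  rw [hA]
  exact (map_ne_zero_iff A A.injective).2 hy

theorem IsFinslerNorm.chart_convex {F : TangentBundle (𝓡∂ n) M → ℝ} (hF : IsFinslerNorm F)
    (a : M) {p y w : EuclideanSpace ℝ (Fin n)} (hp : p ∈ (extChartAt (𝓡∂ n) a).target)
    (hy : y ≠ 0) (hw : w ≠ 0) :
    0 < fderiv ℝ (fun v => fderiv ℝ (fun v' => chartLagrangian F a p v' ^ 2) v w) y w := by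
  obtain ⟨A, hA⟩ := exists_tangentOfChart_eq a hp
  set G : EuclideanSpace ℝ (Fin n) → ℝ :=
    fun v => F ⟨(extChartAt (𝓡∂ n) a).symm p, v⟩ ^ 2
  have h1 : (fun v' => chartLagrangian F a p v' ^ 2) = G ∘ A := by
    ext v
    simp [chartLagrangian, hA, G]
  have h2 : (fun v => fderiv ℝ (G ∘ A) v w) = (fun v => fderiv ℝ G v (A w)) ∘ A := by
    ext v
    rw [A.comp_right_fderiv]
    rfl
  rw [h1, h2, A.comp_right_fderiv]
  have h3 := hF.convex ((extChartAt (𝓡∂ n) a).symm p) (A y) (A w) (by simpa) (by simpa)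
  exact (mul_pos_iff_of_pos_left (by norm_num)).1 h3

end Chart

end Finsler

/-! ### One-forms in charts -/

namespace Finsler

open Function Set Filter Topology

section OneForm

variable {n : ℕ} [NeZero n] {M : Type*} [TopologicalSpace M]
  [ChartedSpace (EuclideanHalfSpace n) M]

/-- The covector field `β` in the coordinates of the chart centred at `a`. -/
noncomputable def chartForm (β : CovectorField n M) (a : M) (q : EuclideanSpace ℝ (Fin n)) :
    EuclideanSpace ℝ (Fin n) →L[ℝ] ℝ :=
  (β ((extChartAt (𝓡∂ n) a).symm q)).comp
    (mfderivWithin 𝓘(ℝ, EuclideanSpace ℝ (Fin n)) (𝓡∂ n) (extChartAt (𝓡∂ n) a).symm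
      (range (𝓡∂ n)) q)

variable [IsManifold (𝓡∂ n) ∞ M]

theorem IsSmoothOneForm.contDiffWithinAt_chartForm {β : CovectorField n M} (hβ : IsSmoothOneForm β)
    (a : M) {p : EuclideanSpace ℝ (Fin n)} (hp : p ∈ (extChartAt (𝓡∂ n) a).target) :
    ContDiffWithinAt ℝ ∞ (chartForm β a) (range (𝓡∂ n)) p := by
  have hT := extChartAt_target_mem_nhdsWithin_of_mem (I := 𝓡∂ n) (x := a) hp
  suffices h : ContDiffOn ℝ ∞ (chartForm β a) (extChartAt (𝓡∂ n) a).target from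
    (h p hp).mono_of_mem_nhdsWithin hT
  rw [contDiffOn_clm_apply]
  intro w
  have h1 := contMDiffOn_extChartAt_symm (I := 𝓡∂ n) (n := ∞) a
  have h2 : ContMDiffOn 𝓘(ℝ, EuclideanSpace ℝ (Fin n)) (𝓡∂ n).tangent ∞
      (fun q => tangentOfChart a q w) (extChartAt (𝓡∂ n) a).target := by
    have h3 : ContMDiff 𝓘(ℝ, EuclideanSpace ℝ (Fin n))
        𝓘(ℝ, EuclideanSpace ℝ (Fin n) × EuclideanSpace ℝ (Fin n)) ∞
        (fun q : EuclideanSpace ℝ (Fin n) => (q, w)) :=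
      (contDiff_id.prodMk contDiff_const).contMDiff
    exact (contMDiffOn_tangentOfChart a).comp h3.contMDiffOn fun q hq => ⟨hq, mem_univ _⟩
  have h4 := hβ.comp_contMDiffOn h1
  have h5 := ContMDiffOn.clm_bundle_apply (F₂ := ℝ) (E₂ := Bundle.Trivial M ℝ) h4 h2
  rw [← contMDiffOn_iff_contDiffOn]
  have h6 : ContMDiffOn ((𝓡∂ n).prod 𝓘(ℝ, ℝ)) 𝓘(ℝ, ℝ) ∞
      (fun z : Bundle.TotalSpace ℝ (Bundle.Trivial M ℝ) => z.2) univ := by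
    intro z _
    exact ((Bundle.contMDiffAt_totalSpace (IB := 𝓡∂ n) (IM := (𝓡∂ n).prod 𝓘(ℝ, ℝ))
      (f := fun z : Bundle.TotalSpace ℝ (Bundle.Trivial M ℝ) => z)).1
        contMDiffAt_id).2.contMDiffWithinAt
  exact h6.comp h5 fun _ _ => mem_univ _

theorem SmoothOffZeroAt.add_clm {E : Type*} [NormedAddCommGroup E] [NormedSpace ℝ E] {S : Set E}
    {L : E → E → ℝ} {b : E → E →L[ℝ] ℝ} {p : E} (hL : SmoothOffZeroAt S L p)
    (hb : ContDiffWithinAt ℝ ∞ b S p) : SmoothOffZeroAt S (fun q v => L q v + b q v) p := by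
  intro y hy
  have h1 : ContDiffWithinAt ℝ ∞ (fun z : E × E => b z.1) (S ×ˢ univ) (p, y) :=
    ContDiffWithinAt.comp (t := S) (g := b) (p, y) hb contDiffWithinAt_fst fun z hz => hz.1
  exact (hL y hy).add (h1.clm_apply contDiffWithinAt_snd)

theorem SmoothOffZeroAt.sq {E : Type*} [NormedAddCommGroup E] [NormedSpace ℝ E] {S : Set E}
    {L : E → E → ℝ} {p : E} (hL : SmoothOffZeroAt S L p) :
    SmoothOffZeroAt S (fun q v => L q v ^ 2) p :=
  fun y hy => (hL y hy).pow 2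

theorem pos_addForm_of_dualNorm_lt_one {F : TangentBundle (𝓡∂ n) M → ℝ} (hF : IsFinslerNorm F)
    (hrev : IsReversible F) {β : CovectorField n M} (hβ : dualNorm F β < 1)
    {v : TangentBundle (𝓡∂ n) M} (hv : v.2 ≠ 0) : 0 < addForm F β v := by
  obtain ⟨x, y⟩ := v
  have hpos := hF.pos hv
  set c := F ⟨x, y⟩
  have h1 : F ⟨x, -(c⁻¹ • y)⟩ = 1 := by
    rw [hrev, hF.homogeneous x y _ (inv_nonneg.2 hpos.le)]
    exact inv_mul_cancel₀ hpos.ne'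
  have h2 : ((β x (-(c⁻¹ • y)) : ℝ) : EReal) < 1 :=
    lt_of_le_of_lt ((le_iSup₂_of_le (f := fun (y : TangentSpace (𝓡∂ n) x) (_ : F ⟨x, y⟩ = 1) =>
      ((β x y : ℝ) : EReal)) _ h1 le_rfl).trans (le_iSup (fun x => coNorm F x (β x)) x)) hβ
  have h3 : β x (-(c⁻¹ • y)) < 1 := by exact_mod_cast h2
  rw [map_neg, map_smul, smul_eq_mul, neg_lt, ← mul_lt_mul_iff_right₀ hpos,
    mul_inv_cancel_left₀ hpos.ne'] at h3
  change 0 < c + β x y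
  linarith

end OneForm

end Finsler

/-! ### Curves in charts -/

namespace Finsler

open Function Set Filter Topology

section Curve

variable {n : ℕ} [NeZero n] {M : Type*} [TopologicalSpace M]
  [ChartedSpace (EuclideanHalfSpace n) M]

/-- The coordinate expression of the curve `γ` in the chart centred at `a`. -/
noncomputable def chartCurve (a : M) (γ : ℝ → M) (t : ℝ) : EuclideanSpace ℝ (Fin n) :=
  extChartAt (𝓡∂ n) a (γ t)

theorem uniqueDiffOn_unitInterval : UniqueDiffOn ℝ (Icc (0 : ℝ) 1) :=
  uniqueDiffOn_Icc_zero_one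

variable {γ : ℝ → M} {t : ℝ} {a : M}

theorem chartCurve_mem_target (ha : γ t ∈ (extChartAt (𝓡∂ n) a).source) :
    chartCurve (n := n) a γ t ∈ (extChartAt (𝓡∂ n) a).target :=
  (extChartAt (𝓡∂ n) a).map_source ha

theorem eventually_mem_source {J : Set ℝ} (hγ : ContinuousWithinAt γ J t)
    (ha : γ t ∈ (extChartAt (𝓡∂ n) a).source) :
    ∀ᶠ s in 𝓝[J] t, γ s ∈ (extChartAt (𝓡∂ n) a).source :=
  hγ.eventually ((isOpen_extChartAt_source a).mem_nhds ha)

theorem tangentOfChart_eq_mk {p w : EuclideanSpace ℝ (Fin n)} {x : M} {v : TangentSpace (𝓡∂ n) x}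
    (hx : x = (extChartAt (𝓡∂ n) a).symm p)
    (hv : v = (mfderivWithin 𝓘(ℝ, EuclideanSpace ℝ (Fin n)) (𝓡∂ n) (extChartAt (𝓡∂ n) a).symm
      (range (𝓡∂ n)) p w : EuclideanSpace ℝ (Fin n))) :
    tangentOfChart a p w = ⟨x, v⟩ := by
  subst hx hv
  rfl

theorem velocity_comp {s : ℝ → ℝ} (hγ : ContMDiffOn 𝓘(ℝ, ℝ) (𝓡∂ n) ∞ γ (Icc 0 1))
    (hs : ContDiffOn ℝ ∞ s (Icc 0 1)) (hmap : MapsTo s (Icc 0 1) (Icc 0 1))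
    (ht : t ∈ Icc (0 : ℝ) 1) :
    velocity (n := n) (γ ∘ s) t =
      ⟨(velocity (n := n) γ (s t)).1, derivWithin s (Icc 0 1) t • (velocity (n := n) γ (s t)).2⟩ := by
  have h1 := mfderivWithin_comp t ((hγ (s t) (hmap ht)).mdifferentiableWithinAt (by simp))
    ((hs t ht).contMDiffWithinAt.mdifferentiableWithinAt (by simp)) hmap
    (uniqueDiffOn_unitInterval t ht).uniqueMDiffWithinAt
  rw [mfderivWithin_eq_fderivWithin] at h1
  let D : ℝ →L[ℝ] EuclideanSpace ℝ (Fin n) := mfderivWithin 𝓘(ℝ, ℝ) (𝓡∂ n) γ (Icc 0 1) (s t)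
  have h2 : D (fderivWithin ℝ s (Icc 0 1) t 1) = derivWithin s (Icc 0 1) t • D 1 := by
    rw [fderivWithin_derivWithin, ← map_smul, smul_eq_mul, mul_one]
  exact congrArg (Bundle.TotalSpace.mk' (EuclideanSpace ℝ (Fin n)) (γ (s t)))
    ((congrArg (fun l : ℝ →L[ℝ] EuclideanSpace ℝ (Fin n) => l 1) h1).trans h2)

variable [IsManifold (𝓡∂ n) ∞ M]

theorem contDiffWithinAt_chartCurve {J : Set ℝ} (hγ : ContMDiffWithinAt 𝓘(ℝ, ℝ) (𝓡∂ n) ∞ γ J t)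
    (ha : γ t ∈ (extChartAt (𝓡∂ n) a).source) :
    ContDiffWithinAt ℝ ∞ (chartCurve (n := n) a γ) J t := by
  rw [← contMDiffWithinAt_iff_contDiffWithinAt]
  rw [extChartAt_source] at ha
  exact (contMDiffAt_extChartAt' ha).comp_contMDiffWithinAt t hγ

theorem contDiffWithinAt_derivWithin_chartCurve
    (hγ : ContMDiffOn 𝓘(ℝ, ℝ) (𝓡∂ n) ∞ γ (Icc 0 1)) (ht : t ∈ Icc (0 : ℝ) 1)
    (ha : γ t ∈ (extChartAt (𝓡∂ n) a).source) :
    ContDiffWithinAt ℝ ∞ (derivWithin (chartCurve (n := n) a γ) (Icc 0 1)) (Icc 0 1) t :=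
  (contDiffWithinAt_chartCurve (hγ t ht) ha).derivWithin uniqueDiffOn_unitInterval (by simp) ht

theorem velocity_eq_tangentOfChart (hγ : ContMDiffOn 𝓘(ℝ, ℝ) (𝓡∂ n) ∞ γ (Icc 0 1))
    (ht : t ∈ Icc (0 : ℝ) 1) (ha : γ t ∈ (extChartAt (𝓡∂ n) a).source) :
    velocity (n := n) γ t =
      tangentOfChart a (chartCurve a γ t) (derivWithin (chartCurve a γ) (Icc 0 1) t) := by
  symm
  have ha' := ha
  rw [extChartAt_source] at ha'
  refine tangentOfChart_eq_mk ((extChartAt (𝓡∂ n) a).left_inv ha).symm ?_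
  have h1 : mfderivWithin 𝓘(ℝ, ℝ) 𝓘(ℝ, EuclideanSpace ℝ (Fin n)) (extChartAt (𝓡∂ n) a ∘ γ)
      (Icc 0 1) t = (mfderiv (𝓡∂ n) 𝓘(ℝ, EuclideanSpace ℝ (Fin n)) (extChartAt (𝓡∂ n) a) (γ t)).comp
        (mfderivWithin 𝓘(ℝ, ℝ) (𝓡∂ n) γ (Icc 0 1) t) :=
    mfderiv_comp_mfderivWithin t (mdifferentiableAt_extChartAt ha')
      ((hγ t ht).mdifferentiableWithinAt (by simp))
      (uniqueDiffOn_unitInterval t ht).uniqueMDiffWithinAt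
  have h2 : derivWithin (chartCurve a γ) (Icc 0 1) t =
      mfderiv (𝓡∂ n) 𝓘(ℝ, EuclideanSpace ℝ (Fin n)) (extChartAt (𝓡∂ n) a) (γ t)
        (mfderivWithin 𝓘(ℝ, ℝ) (𝓡∂ n) γ (Icc 0 1) t (1 : ℝ)) := by
    rw [← fderivWithin_derivWithin, ← mfderivWithin_eq_fderivWithin]
    exact congrArg (fun l : ℝ →L[ℝ] EuclideanSpace ℝ (Fin n) => l 1) h1
  have h3 := mfderivWithin_extChartAt_symm_comp_mfderiv_extChartAt' (I := 𝓡∂ n) ha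
  rw [h2]
  exact (congrArg (fun l : EuclideanSpace ℝ (Fin n) →L[ℝ] EuclideanSpace ℝ (Fin n) =>
    l (mfderivWithin 𝓘(ℝ, ℝ) (𝓡∂ n) γ (Icc 0 1) t (1 : ℝ))) h3).symm

theorem apply_velocity_eq (F : TangentBundle (𝓡∂ n) M → ℝ)
    (hγ : ContMDiffOn 𝓘(ℝ, ℝ) (𝓡∂ n) ∞ γ (Icc 0 1))
    (ht : t ∈ Icc (0 : ℝ) 1) (ha : γ t ∈ (extChartAt (𝓡∂ n) a).source) :
    F (velocity γ t) =
      chartLagrangian F a (chartCurve a γ t) (derivWithin (chartCurve a γ) (Icc 0 1) t) := by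
  rw [velocity_eq_tangentOfChart hγ ht ha, chartLagrangian]

theorem derivWithin_chartCurve_ne_zero (hγ : ContMDiffOn 𝓘(ℝ, ℝ) (𝓡∂ n) ∞ γ (Icc 0 1))
    (ht : t ∈ Icc (0 : ℝ) 1) (ha : γ t ∈ (extChartAt (𝓡∂ n) a).source)
    (hv : (velocity (n := n) γ t).2 ≠ 0) :
    derivWithin (chartCurve (n := n) a γ) (Icc 0 1) t ≠ 0 := by
  rw [velocity_eq_tangentOfChart hγ ht ha] at hv
  intro h0
  apply hv
  rw [h0]
  exact map_zero _

/-- An unparametrized geodesic of `F`: a regular smooth curve which satisfies the Euler–Lagrange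
equation of the length functional in every chart. -/
structure IsPregeodesic (F : TangentBundle (𝓡∂ n) M → ℝ) (γ : ℝ → M) : Prop where
  smooth : ContMDiffOn 𝓘(ℝ, ℝ) (𝓡∂ n) ∞ γ (Icc 0 1)
  regular : ∀ t ∈ Icc (0 : ℝ) 1, (velocity (n := n) γ t).2 ≠ 0
  equation : ∀ t ∈ Icc (0 : ℝ) 1, ∀ a : M, γ t ∈ (extChartAt (𝓡∂ n) a).source → ∀ w,
    eulerLagrange (range (𝓡∂ n)) (chartLagrangian F a) (chartCurve a γ t)
      (derivWithin (chartCurve a γ) (Icc 0 1) t)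
      (derivWithin (derivWithin (chartCurve a γ) (Icc 0 1)) (Icc 0 1) t) w = 0

theorem contDiffOn_apply_velocity {F : TangentBundle (𝓡∂ n) M → ℝ} (hF : IsFinslerNorm F)
    (hγ : ContMDiffOn 𝓘(ℝ, ℝ) (𝓡∂ n) ∞ γ (Icc 0 1))
    (hreg : ∀ t ∈ Icc (0 : ℝ) 1, (velocity (n := n) γ t).2 ≠ 0) :
    ContDiffOn ℝ ∞ (fun s => F (velocity γ s)) (Icc 0 1) := by
  intro t ht
  have ha := mem_extChartAt_source (I := 𝓡∂ n) (γ t)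
  have h1 := (contDiffWithinAt_chartCurve (hγ t ht) ha).prodMk
    (contDiffWithinAt_derivWithin_chartCurve hγ ht ha)
  have h2 := hF.smoothOffZeroAt (γ t) (chartCurve_mem_target ha) _
    (derivWithin_chartCurve_ne_zero hγ ht ha (hreg t ht))
  have hev := eventually_mem_source (hγ t ht).continuousWithinAt ha
  have h3 : ContDiffWithinAt ℝ ∞ (fun s => chartLagrangian F (γ t) (chartCurve (γ t) γ s)
      (derivWithin (chartCurve (γ t) γ) (Icc 0 1) s)) (Icc 0 1) t := by
    refine ContDiffWithinAt.comp_of_mem_nhdsWithin_image (g := uncurry (chartLagrangian F (γ t)))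
      (f := fun s => (chartCurve (γ t) γ s, derivWithin (chartCurve (γ t) γ) (Icc 0 1) s))
      t h2 h1 ?_
    refine mem_of_superset self_mem_nhdsWithin ?_
    rintro _ ⟨s, _, rfl⟩
    exact ⟨mem_range_self _, mem_univ _⟩
  refine h3.congr_of_eventuallyEq ?_ (apply_velocity_eq F hγ ht ha)
  filter_upwards [hev, self_mem_nhdsWithin] with s hs hsJ using apply_velocity_eq F hγ hsJ hs

/-- A curve satisfying the spray equation of `F + β`, with `β` closed, is an unparametrized geodesic
of `F`. -/
theorem IsGeodesic.isPregeodesic {F : TangentBundle (𝓡∂ n) M → ℝ} (hF : IsFinslerNorm F)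
    {β : CovectorField n M} (hβ : IsSmoothOneForm β) (hclosed : IsClosedForm β)
    (hpos : ∀ v : TangentBundle (𝓡∂ n) M, v.2 ≠ 0 → 0 < addForm F β v)
    (hγ : IsGeodesic (addForm F β) γ) : IsPregeodesic F γ := by
  refine ⟨hγ.smooth, hγ.regular, fun t ht a ha w => ?_⟩
  have hp := chartCurve_mem_target ha
  have hpS := extChartAt_target_subset_range a hp
  have hy := derivWithin_chartCurve_ne_zero hγ.smooth ht ha (hγ.regular t ht)
  have hU := uniqueDiffWithinAt_range_of_mem_target a hp
  set p : EuclideanSpace ℝ (Fin n) := chartCurve a γ t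
  set y := derivWithin (chartCurve (n := n) a γ) (Icc 0 1) t
  have hL := hF.smoothOffZeroAt a hp
  have hLn := hF.eventually_smoothOffZeroAt a hp
  have hb := hβ.contDiffWithinAt_chartForm a hp
  have hLb := hL.add_clm hb
  have hLbn : ∀ᶠ q in 𝓝[range (𝓡∂ n)] p, SmoothOffZeroAt (range (𝓡∂ n))
      (fun q v => chartLagrangian F a q v + chartForm β a q v) q := by
    filter_upwards [extChartAt_target_mem_nhdsWithin_of_mem hp] with q hq
      using (hF.smoothOffZeroAt a hq).add_clm (hβ.contDiffWithinAt_chartForm a hq)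
  have hom : ∀ q v (c : ℝ), 0 ≤ c → chartLagrangian F a q (c • v) = c * chartLagrangian F a q v :=
    fun q v c hc => chartLagrangian_smul (fun x z => hF.homogeneous x z c hc) a q v
  have hposchart : ∀ v ≠ 0, 0 < chartLagrangian F a p v + chartForm β a p v := by
    intro v hv
    refine hpos (tangentOfChart a p v) ?_
    obtain ⟨A, hA⟩ := exists_tangentOfChart_eq a hp
    rw [hA]
    exact (map_ne_zero_iff A A.injective).2 hv
  have hspray := (add_spray_eq_zero_iff hpS hy
    (F := addForm F β) (a := a) (p := p) hLb.sq ?_ _).1 (hγ.equation t ht a ha)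
  · have h1 := eulerLagrange_eq_zero_of_sq hLb hLbn hpS hU hy
      (fun q v c hc => by rw [hom q v c hc, map_smul, smul_eq_mul]; ring) (hposchart y hy) hspray w
    rwa [eulerLagrange_add hL hLn hpS hU hy
      (fun w => (hb.differentiableWithinAt (by simp)).clm_apply (differentiableWithinAt_const w))
      (hclosed a p hp)] at h1
  · intro w hw
    exact hessian_sq_add_nondegenerate (fun v hv => hL.contDiffAt hpS hv) (hom p)
      (fun v hv => hF.chart_pos a hp hv) (fun y w hy hw => hF.chart_convex a hp hy hw)
      (chartForm β a p) hposchart hy hw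

/-- An unparametrized geodesic with constant speed is a geodesic. -/
theorem IsPregeodesic.isGeodesic {F : TangentBundle (𝓡∂ n) M → ℝ} (hF : IsFinslerNorm F)
    (hγ : IsPregeodesic F γ) {C : ℝ} (hC : ∀ t ∈ Icc (0 : ℝ) 1, F (velocity γ t) = C) :
    IsGeodesic F γ := by
  refine ⟨hγ.smooth, hγ.regular, fun t ht a ha => ?_⟩
  have hp := chartCurve_mem_target ha
  have hpS := extChartAt_target_subset_range a hp
  have hy := derivWithin_chartCurve_ne_zero hγ.smooth ht ha (hγ.regular t ht)
  have hU := uniqueDiffWithinAt_range_of_mem_target a hp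
  have hL := hF.smoothOffZeroAt a hp
  have hLn := hF.eventually_smoothOffZeroAt a hp
  refine (add_spray_eq_zero_iff hpS hy (F := F) (a := a) hL.sq ?_ _).2 fun w => ?_
  · intro w hw
    by_contra hw0
    exact (hF.chart_convex a hp hy hw0).ne' hw
  · change eulerLagrange _ (fun q v => chartLagrangian F a q v ^ 2) _ _ _ _ = 0
    rw [eulerLagrange_sq hL hLn hpS hU hy]
    have hE := hγ.equation t ht a ha w
    have hu := ((contDiffWithinAt_chartCurve (hγ.smooth t ht) ha).differentiableWithinAt
      (by simp)).hasDerivWithinAt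
    have hu' := ((contDiffWithinAt_derivWithin_chartCurve hγ.smooth ht ha).differentiableWithinAt
      (by simp)).hasDerivWithinAt
    have h1 := hL.hasDerivWithinAt_comp hpS hU hy hu hu' rfl rfl
      (Eventually.of_forall fun s => mem_range_self _)
    have h2 : HasDerivWithinAt (fun s => chartLagrangian F a (chartCurve a γ s)
        (derivWithin (chartCurve a γ) (Icc 0 1) s)) 0 (Icc 0 1) t := by
      refine (hasDerivWithinAt_const t (Icc 0 1) C).congr_of_eventuallyEq ?_ ?_
      · filter_upwards [eventually_mem_source (hγ.smooth t ht).continuousWithinAt ha,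
          self_mem_nhdsWithin] with s hs hsJ
        rw [← apply_velocity_eq F hγ.smooth hsJ hs, hC s hsJ]
      · rw [← apply_velocity_eq F hγ.smooth ht ha, hC t ht]
    have h3 := (uniqueDiffOn_unitInterval t ht).eq_deriv _ h1 h2
    have h4 : eulerLagrange (range (𝓡∂ n)) (chartLagrangian F a) (chartCurve a γ t)
      (derivWithin (chartCurve a γ) (Icc 0 1) t)
      (derivWithin (derivWithin (fun s => extChartAt (𝓡∂ n) a (γ s)) (Icc 0 1)) (Icc 0 1) t) w = 0 :=
      hE
    have h5 : fderivWithin ℝ (fun q => chartLagrangian F a q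
          (derivWithin (chartCurve a γ) (Icc 0 1) t)) (range (𝓡∂ n)) (chartCurve a γ t)
          (derivWithin (chartCurve a γ) (Icc 0 1) t)
        + fderiv ℝ (chartLagrangian F a (chartCurve a γ t))
          (derivWithin (chartCurve a γ) (Icc 0 1) t)
          (derivWithin (derivWithin (fun s => extChartAt (𝓡∂ n) a (γ s)) (Icc 0 1)) (Icc 0 1) t)
        = 0 := h3
    rw [h4, h5]
    simp

section Reparametrization

variable {s : ℝ → ℝ}

theorem derivWithin_chartCurve_comp (hγ : ContMDiffOn 𝓘(ℝ, ℝ) (𝓡∂ n) ∞ γ (Icc 0 1))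
    (hs : ContDiffOn ℝ ∞ s (Icc 0 1)) (hmap : MapsTo s (Icc 0 1) (Icc 0 1))
    (ht : t ∈ Icc (0 : ℝ) 1) (ha : γ (s t) ∈ (extChartAt (𝓡∂ n) a).source) :
    derivWithin (chartCurve (n := n) a (γ ∘ s)) (Icc 0 1) t =
      derivWithin s (Icc 0 1) t • derivWithin (chartCurve (n := n) a γ) (Icc 0 1) (s t) := by
  have h1 := ((contDiffWithinAt_chartCurve (hγ (s t) (hmap ht)) ha).differentiableWithinAt
      (by simp)).hasDerivWithinAt
  have h2 := ((hs t ht).differentiableWithinAt (by simp)).hasDerivWithinAt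
  exact (h1.scomp t h2 hmap).derivWithin (uniqueDiffOn_unitInterval t ht)

theorem derivWithin_derivWithin_chartCurve_comp (hγ : ContMDiffOn 𝓘(ℝ, ℝ) (𝓡∂ n) ∞ γ (Icc 0 1))
    (hs : ContDiffOn ℝ ∞ s (Icc 0 1)) (hmap : MapsTo s (Icc 0 1) (Icc 0 1))
    (ht : t ∈ Icc (0 : ℝ) 1) (ha : γ (s t) ∈ (extChartAt (𝓡∂ n) a).source) :
    derivWithin (derivWithin (chartCurve (n := n) a (γ ∘ s)) (Icc 0 1)) (Icc 0 1) t =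
      derivWithin s (Icc 0 1) t ^ 2 •
        derivWithin (derivWithin (chartCurve (n := n) a γ) (Icc 0 1)) (Icc 0 1) (s t)
      + derivWithin (derivWithin s (Icc 0 1)) (Icc 0 1) t •
        derivWithin (chartCurve (n := n) a γ) (Icc 0 1) (s t) := by
  have h1 := ((contDiffWithinAt_derivWithin_chartCurve hγ (hmap ht) ha).differentiableWithinAt
      (by simp)).hasDerivWithinAt
  have h2 := ((hs t ht).differentiableWithinAt (by simp)).hasDerivWithinAt
  have h3 := (((hs t ht).derivWithin uniqueDiffOn_unitInterval (m := ∞)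
    (by simp) ht).differentiableWithinAt (by simp)).hasDerivWithinAt
  have h4 := h3.smul (h1.scomp t h2 hmap)
  have h5 : derivWithin (chartCurve (n := n) a (γ ∘ s)) (Icc 0 1) =ᶠ[𝓝[Icc 0 1] t]
      derivWithin s (Icc 0 1) • (derivWithin (chartCurve (n := n) a γ) (Icc 0 1) ∘ s) := by
    have hc : ContinuousWithinAt (γ ∘ s) (Icc 0 1) t :=
      (hγ (s t) (hmap ht)).continuousWithinAt.comp (hs t ht).continuousWithinAt hmap
    filter_upwards [eventually_mem_source (a := a) hc ha, self_mem_nhdsWithin] with r hr hrJ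
      using derivWithin_chartCurve_comp hγ hs hmap hrJ hr
  rw [h5.derivWithin_eq (derivWithin_chartCurve_comp hγ hs hmap ht ha),
    HasDerivWithinAt.derivWithin h4 (uniqueDiffOn_unitInterval t ht)]
  simp [smul_smul, sq]

theorem IsPregeodesic.comp {F : TangentBundle (𝓡∂ n) M → ℝ} (hF : IsFinslerNorm F)
    (hrev : IsReversible F) (hγ : IsPregeodesic F γ) (hs : ContDiffOn ℝ ∞ s (Icc 0 1))
    (hmap : MapsTo s (Icc 0 1) (Icc 0 1))
    (hs0 : ∀ t ∈ Icc (0 : ℝ) 1, derivWithin s (Icc 0 1) t ≠ 0) : IsPregeodesic F (γ ∘ s) := by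
  refine ⟨hγ.smooth.comp hs.contMDiffOn hmap, fun t ht => ?_, fun t ht a ha w => ?_⟩
  · rw [velocity_comp hγ.smooth hs hmap ht]
    exact smul_ne_zero (hs0 t ht) (hγ.regular (s t) (hmap ht))
  · have hp := chartCurve_mem_target (γ := γ) (t := s t) ha
    have hpS := extChartAt_target_subset_range a hp
    have hy := derivWithin_chartCurve_ne_zero hγ.smooth (hmap ht) ha (hγ.regular _ (hmap ht))
    have h1 := eulerLagrange_smul (hF.smoothOffZeroAt a hp) hpS
      (uniqueDiffWithinAt_range_of_mem_target a hp) hy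
      (fun q v c => chartLagrangian_smul (hF.abs_homogeneous hrev c) a q v) (hs0 t ht)
      (derivWithin (derivWithin s (Icc 0 1)) (Icc 0 1) t)
      (derivWithin (derivWithin (chartCurve (n := n) a γ) (Icc 0 1)) (Icc 0 1) (s t)) w
    rw [hγ.equation (s t) (hmap ht) a ha, mul_zero] at h1
    rw [derivWithin_chartCurve_comp hγ.smooth hs hmap ht ha,
      derivWithin_derivWithin_chartCurve_comp hγ.smooth hs hmap ht ha]
    exact h1

end Reparametrization

end Curve

end Finsler

/-! ### Parametrization proportional to arc length -/

namespace Finsler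

open Function Set Filter Topology MeasureTheory

/-- A positive smooth function `f` on `[0, 1]` becomes constant after the change of variables
`s` with `s' * f ∘ s` constant. -/
theorem exists_reparametrization {f : ℝ → ℝ} (hf : ContDiffOn ℝ ∞ f (Icc 0 1))
    (hpos : ∀ t ∈ Icc (0 : ℝ) 1, 0 < f t) :
    ∃ s : ℝ → ℝ, ContDiffOn ℝ ∞ s (Icc 0 1) ∧ MapsTo s (Icc 0 1) (Icc 0 1) ∧ s 0 = 0 ∧ s 1 = 1 ∧
      ∀ t ∈ Icc (0 : ℝ) 1, 0 < derivWithin s (Icc 0 1) t ∧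
        derivWithin s (Icc 0 1) t * f (s t) = ∫ x in (0 : ℝ)..1, f x := by
  set g : ℝ → ℝ := IccExtend zero_le_one ((Icc (0 : ℝ) 1).domRestrict f) with hg
  have hgc : Continuous g := (continuousOn_iff_continuous_domRestrict.1 hf.continuousOn).Icc_extend'
  have hgf : ∀ t ∈ Icc (0 : ℝ) 1, g t = f t := fun t ht => by
    rw [hg, IccExtend_of_mem _ _ ht]
    rfl
  obtain ⟨t₀, ht₀, hmin⟩ := isCompact_Icc.exists_isMinOn (nonempty_Icc.2 zero_le_one)
    hf.continuousOn
  set m := f t₀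
  have hm : 0 < m := hpos t₀ ht₀
  have hgm : ∀ t, m ≤ g t := fun t => hmin (projIcc (0 : ℝ) 1 zero_le_one t).2
  set Λ : ℝ → ℝ := fun x => ∫ t in (0 : ℝ)..x, g t
  have hΛ : ∀ x, HasDerivAt Λ (g x) x := fun x => hgc.integral_hasStrictDerivAt 0 x |>.hasDerivAt
  have hΛ0 : Λ 0 = 0 := intervalIntegral.integral_same
  have hmono : StrictMono Λ := strictMono_of_deriv_pos fun x => by
    rw [(hΛ x).deriv]
    exact hm.trans_le (hgm x)
  have hdiff : Monotone fun x => Λ x - m * x := by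
    have hd : ∀ x, HasDerivAt (fun x => Λ x - m * x) (g x - m) x := fun x => by
      simpa using (hΛ x).fun_sub ((hasDerivAt_id x).const_mul m)
    refine monotone_of_deriv_nonneg (fun x => (hd x).differentiableAt) fun x => ?_
    rw [(hd x).deriv]
    exact sub_nonneg.2 (hgm x)
  have hcont : Continuous Λ := continuous_iff_continuousAt.2 fun x => (hΛ x).continuousAt
  have hsurj : Surjective Λ := by
    refine hcont.surjective ?_ ?_
    · refine tendsto_atTop_mono' atTop ?_ (tendsto_id.const_mul_atTop hm)
      filter_upwards [eventually_ge_atTop 0] with x hx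
      have := hdiff hx
      simp only [hΛ0, mul_zero, sub_zero] at this
      exact sub_nonneg.1 this
    · refine tendsto_atBot_mono' atBot ?_ (tendsto_id.const_mul_atBot hm)
      filter_upwards [eventually_le_atBot 0] with x hx
      have := hdiff hx
      simp only [hΛ0, mul_zero, sub_zero] at this
      exact sub_nonpos.1 this
  let e : ℝ ≃o ℝ := hmono.orderIsoOfSurjective Λ hsurj
  have heΛ : ∀ x, Λ (e.symm x) = x := fun x => e.apply_symm_apply x
  have hsymm : ∀ x, e.symm (Λ x) = x := fun x => e.symm_apply_apply x
  have he : ∀ y, HasDerivAt e.symm (g (e.symm y))⁻¹ y := fun y =>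
    HasDerivAt.of_local_left_inverse e.symm.continuous.continuousAt (hΛ _)
      (hm.trans_le (hgm _)).ne' (Eventually.of_forall heΛ)
  set C := Λ 1
  have hC : 0 < C := hΛ0 ▸ hmono zero_lt_one
  have hCf : C = ∫ x in (0 : ℝ)..1, f x := by
    refine intervalIntegral.integral_congr fun x hx => hgf x ?_
    rwa [uIcc_of_le zero_le_one] at hx
  set s : ℝ → ℝ := fun t => e.symm (C * t)
  have hs0 : s 0 = 0 := by
    simp only [s, mul_zero]
    rw [← hΛ0, hsymm, hΛ0]
  have hs1 : s 1 = 1 := by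
    simp only [s, mul_one]
    exact hsymm 1
  have hsmono : Monotone s := fun x y hxy =>
    e.symm.monotone (mul_le_mul_of_nonneg_left hxy hC.le)
  have hmap : MapsTo s (Icc 0 1) (Icc 0 1) := fun t ht =>
    ⟨hs0 ▸ hsmono ht.1, hs1 ▸ hsmono ht.2⟩
  have hds : ∀ t, HasDerivAt s (C / g (s t)) t := fun t => by
    have := (he (C * t)).comp t ((hasDerivAt_id t).const_mul C)
    convert! this using 1
    simp only [s]
    field_simp
  have hderiv : ∀ t ∈ Icc (0 : ℝ) 1, derivWithin s (Icc 0 1) t = C / f (s t) := fun t ht => by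
    rw [← hgf _ (hmap ht)]
    exact (hds t).hasDerivWithinAt.derivWithin (uniqueDiffOn_unitInterval t ht)
  have hdiffs : DifferentiableOn ℝ s (Icc 0 1) := fun t _ =>
    (hds t).differentiableAt.differentiableWithinAt
  refine ⟨s, ?_, hmap, hs0, hs1, fun t ht => ?_⟩
  · refine contDiffOn_infty.2 fun k => ?_
    induction k with
    | zero => exact contDiffOn_zero.2 hdiffs.continuousOn
    | succ k ih =>
      push_cast
      refine (contDiffOn_succ_iff_derivWithin uniqueDiffOn_unitInterval).2
        ⟨hdiffs, by simp, ContDiffOn.congr ?_ hderiv⟩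
      exact contDiffOn_const.div ((hf.of_le (by exact_mod_cast le_top)).comp ih hmap)
        fun t ht => (hpos _ (hmap ht)).ne'
  · rw [hderiv t ht, ← hCf]
    have := hpos _ (hmap ht)
    exact ⟨by positivity, div_mul_cancel₀ _ this.ne'⟩

section Length

variable {n : ℕ} [NeZero n] {M : Type*} [TopologicalSpace M]
  [ChartedSpace (EuclideanHalfSpace n) M]

theorem velocity_congr {γ γ' : ℝ → M} (h : EqOn γ γ' (Icc 0 1)) {t : ℝ} (ht : t ∈ Icc (0 : ℝ) 1) :
    velocity (n := n) γ t = velocity γ' t := by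
  have h1 : mfderivWithin 𝓘(ℝ, ℝ) (𝓡∂ n) γ (Icc 0 1) t =
      mfderivWithin 𝓘(ℝ, ℝ) (𝓡∂ n) γ' (Icc 0 1) t :=
    mfderivWithin_congr h (h ht)
  have h2 : ∀ {x y : M} (_ : x = y) (v w : EuclideanSpace ℝ (Fin n)) (_ : v = w),
      (⟨x, v⟩ : TangentBundle (𝓡∂ n) M) = ⟨y, w⟩ := by
    rintro x _ rfl v _ rfl
    rfl
  exact h2 (h ht) _ _ (congrArg (fun l : ℝ →L[ℝ] EuclideanSpace ℝ (Fin n) => l 1) h1)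

theorem length_congr (F : TangentBundle (𝓡∂ n) M → ℝ) {γ γ' : ℝ → M}
    (h : EqOn γ γ' (Icc 0 1)) : length F γ = length F γ' := by
  refine intervalIntegral.integral_congr fun t ht => ?_
  rw [uIcc_of_le zero_le_one] at ht
  simp only [velocity_congr h ht]

theorem boundaryDist_self (F : TangentBundle (𝓡∂ n) M → ℝ) (x : M) : boundaryDist F x x = 0 := by
  simp [boundaryDist]

theorem IsAdmissible.exists_boundaryDist_eq {F : TangentBundle (𝓡∂ n) M → ℝ} (hF : IsAdmissible F)
    {x x' : M} (hx : x ∈ (𝓡∂ n).boundary M) (hx' : x' ∈ (𝓡∂ n).boundary M) (hne : x ≠ x') :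
    ∃ γ, IsGeodesicFromTo F x x' γ ∧ boundaryDist F x x' = length F γ := by
  obtain ⟨γ, hγ, -⟩ := hF x hx x' hx' hne
  have h : ∃ γ, IsGeodesicFromTo F x x' γ := ⟨γ, hγ⟩
  exact ⟨h.choose, h.choose_spec, by rw [boundaryDist, if_neg hne, dif_pos h]⟩

theorem IsAdmissible.boundaryDist_eq_length {F : TangentBundle (𝓡∂ n) M → ℝ} (hF : IsAdmissible F)
    {x x' : M} (hx : x ∈ (𝓡∂ n).boundary M) (hx' : x' ∈ (𝓡∂ n).boundary M) (hne : x ≠ x')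
    {γ : ℝ → M} (hγ : IsGeodesicFromTo F x x' γ) : boundaryDist F x x' = length F γ := by
  obtain ⟨γ', hγ', h⟩ := hF.exists_boundaryDist_eq hx hx' hne
  obtain ⟨γ₀, -, hu⟩ := hF x hx x' hx' hne
  rw [h]
  exact length_congr F ((hu γ' hγ').trans (hu γ hγ).symm)

theorem isClosedForm_zero : IsClosedForm (0 : CovectorField n M) := by
  intro a p _ v w
  simp

theorem addForm_zero (F : TangentBundle (𝓡∂ n) M → ℝ) : addForm F 0 = F := by
  ext v
  simp [addForm]

variable [IsManifold (𝓡∂ n) ∞ M]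

/-- The boundary distance is the length of any unparametrized geodesic. -/
theorem IsPregeodesic.boundaryDist_eq_length {F : TangentBundle (𝓡∂ n) M → ℝ}
    (hF : IsFinslerNorm F) (hrev : IsReversible F) (hadm : IsAdmissible F) {γ : ℝ → M}
    (hγ : IsPregeodesic F γ) (hx : γ 0 ∈ (𝓡∂ n).boundary M) (hx' : γ 1 ∈ (𝓡∂ n).boundary M)
    (hne : γ 0 ≠ γ 1) : boundaryDist F (γ 0) (γ 1) = length F γ := by
  obtain ⟨s, hs, hmap, hs0, hs1, hsf⟩ := exists_reparametrization
    (contDiffOn_apply_velocity hF hγ.smooth hγ.regular) fun t ht => hF.pos (hγ.regular t ht)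
  have hspeed : ∀ t ∈ Icc (0 : ℝ) 1, F (velocity (γ ∘ s) t) = length F γ := fun t ht => by
    rw [velocity_comp hγ.smooth hs hmap ht, hF.homogeneous _ _ _ (hsf t ht).1.le]
    exact (hsf t ht).2
  have hgeo := (hγ.comp hF hrev hs hmap fun t ht => (hsf t ht).1.ne').isGeodesic hF hspeed
  rw [hadm.boundaryDist_eq_length hx hx' hne (γ := γ ∘ s) ⟨hgeo, by simp [hs0], by simp [hs1]⟩]
  rw [length, intervalIntegral.integral_congr (g := fun _ => length F γ)]
  · simp
  · intro t ht
    rw [uIcc_of_le zero_le_one] at ht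
    exact hspeed t ht

theorem isSmoothOneForm_zero : IsSmoothOneForm (0 : CovectorField n M) :=
  Bundle.contMDiff_zeroSection ℝ (fun x : M => TangentSpace (𝓡∂ n) x →L[ℝ] Bundle.Trivial M ℝ x)

theorem boundaryDist_comm {F : TangentBundle (𝓡∂ n) M → ℝ}
    (hF : IsFinslerNorm F) (hrev : IsReversible F) (hadm : IsAdmissible F) {x x' : M}
    (hx : x ∈ (𝓡∂ n).boundary M) (hx' : x' ∈ (𝓡∂ n).boundary M) :
    boundaryDist F x x' = boundaryDist F x' x := by
  by_cases hne : x = x'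
  · rw [hne]
  obtain ⟨γ, ⟨hγ, rfl, rfl⟩, hlen⟩ := hadm.exists_boundaryDist_eq hx hx' hne
  have hpre : IsPregeodesic F γ := IsGeodesic.isPregeodesic hF isSmoothOneForm_zero
    isClosedForm_zero (fun v hv => by rw [addForm_zero]; exact hF.pos hv)
    (by rwa [addForm_zero])
  have hs : ContDiffOn ℝ ∞ (fun t : ℝ => 1 - t) (Icc 0 1) := by fun_prop
  have hmap : MapsTo (fun t : ℝ => 1 - t) (Icc 0 1) (Icc 0 1) := fun t ht =>
    ⟨by linarith [ht.2], by linarith [ht.1]⟩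
  have hd : ∀ t ∈ Icc (0 : ℝ) 1, derivWithin (fun t : ℝ => 1 - t) (Icc 0 1) t = -1 := fun t ht =>
    ((hasDerivAt_id t).const_sub 1).hasDerivWithinAt.derivWithin (uniqueDiffOn_unitInterval t ht)
  have hrevγ := hpre.comp hF hrev hs hmap fun t ht => by simp [hd t ht]
  have h1 := hrevγ.boundaryDist_eq_length hF hrev hadm (by simpa) (by simpa)
    (by simpa using Ne.symm hne)
  simp only [comp_apply, sub_zero, sub_self] at h1
  rw [h1, hlen, length, length]
  have h2 : ∀ t ∈ Icc (0 : ℝ) 1,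
      F (velocity (γ ∘ fun t : ℝ => 1 - t) t) = F (velocity γ (1 - t)) := by
    intro t ht
    rw [velocity_comp hγ.smooth hs hmap ht, hd t ht, hF.abs_homogeneous hrev]
    simp
  rw [intervalIntegral.integral_congr (a := 0) (b := 1) (f := fun t => F (velocity (γ ∘ _) t))
    (g := fun t => F (velocity γ (1 - t)))]
  · rw [intervalIntegral.integral_comp_sub_left (fun t => F (velocity γ t)) 1]
    simp
  · intro t ht
    rw [uIcc_of_le zero_le_one] at ht
    exact h2 t ht

end Length

end Finsler

/-! ### Potentials of closed one-forms on simply connected manifolds -/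

namespace Finsler

open Function Set Filter Topology

section Covering

variable {X : Type*} [TopologicalSpace X]

/-- The real numbers with the discrete topology. -/
@[ext]
structure DiscreteReal where
  /-- The underlying real number. -/
  val : ℝ

instance : TopologicalSpace DiscreteReal := ⊥

instance : DiscreteTopology DiscreteReal := ⟨rfl⟩

/-- The covering space of germs of the functions `Ψ i + c`, given that the differences
`Ψ i - Ψ j` are locally constant. -/
def germCore (U : X → Set X) (hU : ∀ i, IsOpen (U i)) (hmem : ∀ x, x ∈ U x) (Ψ : X → X → ℝ)
    (h : ∀ i j, ∀ x ∈ U i ∩ U j, ∀ᶠ y in 𝓝 x, Ψ i y - Ψ j y = Ψ i x - Ψ j x) :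
    FiberBundleCore X X DiscreteReal where
  baseSet := U
  isOpen_baseSet := hU
  indexAt := id
  mem_baseSet_at := hmem
  coordChange i j x v := ⟨v.val + (Ψ i x - Ψ j x)⟩
  coordChange_self i x _ v := by
    ext
    ring
  continuousOn_coordChange i j := by
    rintro ⟨x, v⟩ ⟨hx, -⟩
    have h1 : ∀ᶠ p : X × DiscreteReal in 𝓝 (x, v), p.2 = v :=
      ((continuous_snd (X := X)).tendsto (x, v)).eventually (p := fun w => w = v)
        ((isOpen_discrete {v}).mem_nhds rfl)
    have h2 : ∀ᶠ p : X × DiscreteReal in 𝓝 (x, v), Ψ i p.1 - Ψ j p.1 = Ψ i x - Ψ j x :=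
      ((continuous_fst (Y := DiscreteReal)).tendsto (x, v)).eventually (h i j x hx)
    refine ContinuousAt.continuousWithinAt ?_
    refine (continuousAt_const (y := DiscreteReal.mk (v.val + (Ψ i x - Ψ j x)))).congr ?_
    filter_upwards [h1, h2] with p hp1 hp2
    rw [hp1, hp2]
  coordChange_comp i j k x _ v := by
    ext
    ring

theorem exists_glue_of_simplyConnected [SimplyConnectedSpace X] [LocallyPathConnectedSpace X]
    (U : X → Set X) (hU : ∀ i, IsOpen (U i)) (hmem : ∀ x, x ∈ U x) (Ψ : X → X → ℝ)
    (h : ∀ i j, ∀ x ∈ U i ∩ U j, ∀ᶠ y in 𝓝 x, Ψ i y - Ψ j y = Ψ i x - Ψ j x) :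
    ∃ φ : X → ℝ, ∀ i, ∀ x ∈ U i, ∀ᶠ y in 𝓝 x, φ y - Ψ i y = φ x - Ψ i x := by
  let Z := germCore U hU hmem Ψ h
  have hcov : IsCoveringMap Z.proj :=
    IsFiberBundle.isCoveringMap fun x => ⟨Z.localTriv x, hmem x⟩
  let x₀ : X := Classical.arbitrary X
  obtain ⟨s, ⟨-, hs⟩, -⟩ := hcov.existsUnique_continuousMap_lifts (ContinuousMap.id X) x₀
    ⟨x₀, ⟨0⟩⟩ rfl
  have hproj : ∀ x, (s x).1 = x := fun x => congrFun hs x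
  let c : X → ℝ := fun x => DiscreteReal.val (s x).2
  refine ⟨fun x => c x + Ψ x x, fun i x hx => ?_⟩
  have hloc : ∀ y, (Z.localTriv i (s y)).2.val = c y + (Ψ y y - Ψ i y) := by
    intro y
    change c y + (Ψ (s y).1 (s y).1 - Ψ i (s y).1) = _
    rw [hproj]
  have hcont : ContinuousAt (fun y => (Z.localTriv i (s y)).2) x := by
    have h1 : ContinuousAt (Z.localTriv i) (s x) := (Z.localTriv i).continuousAt <| by
      rw [(Z.localTriv i).mem_source]
      change (s x).1 ∈ U i
      rwa [hproj]
    exact continuous_snd.continuousAt.comp (h1.comp s.continuous.continuousAt)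
  have h2 : ∀ᶠ y in 𝓝 x, (Z.localTriv i (s y)).2 = (Z.localTriv i (s x)).2 :=
    hcont.eventually ((isOpen_discrete {(Z.localTriv i (s x)).2}).mem_nhds rfl)
  filter_upwards [h2] with y hy
  have h3 : c y + (Ψ y y - Ψ i y) = c x + (Ψ x x - Ψ i x) := by
    rw [← hloc, ← hloc, hy]
  linarith

end Covering

section Potential

variable {n : ℕ} [NeZero n] {M : Type*} [TopologicalSpace M]
  [ChartedSpace (EuclideanHalfSpace n) M]

theorem exists_ball_inter_range_subset {p : EuclideanSpace ℝ (Fin n)}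
    {s : Set (EuclideanSpace ℝ (Fin n))} (hs : s ∈ 𝓝[range (𝓡∂ n)] p) :
    ∃ r > 0, range (𝓡∂ n) ∩ Metric.ball p r ⊆ s := by
  obtain ⟨r, hr, h⟩ := Metric.mem_nhdsWithin_iff.1 hs
  exact ⟨r, hr, by rwa [inter_comm]⟩

theorem convex_range_inter_ball (p : EuclideanSpace ℝ (Fin n)) (r : ℝ) :
    Convex ℝ (range (𝓡∂ n) ∩ Metric.ball p r) :=
  (𝓡∂ n).convex_range.inter (convex_ball p r)

theorem uniqueDiffOn_range_inter_ball (p : EuclideanSpace ℝ (Fin n)) (r : ℝ) :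
    UniqueDiffOn ℝ (range (𝓡∂ n) ∩ Metric.ball p r) :=
  (𝓡∂ n).uniqueDiffOn.inter Metric.isOpen_ball

variable [IsManifold (𝓡∂ n) ∞ M]

theorem eventually_eq_of_hasMFDerivAt_zero {g : M → ℝ} {x : M}
    (hg : ∀ᶠ y in 𝓝 x, HasMFDerivAt (𝓡∂ n) 𝓘(ℝ, ℝ) g y
      (0 : EuclideanSpace ℝ (Fin n) →L[ℝ] ℝ)) :
    ∀ᶠ y in 𝓝 x, g y = g x := by
  set e := extChartAt (𝓡∂ n) x
  have hp : e x ∈ e.target := mem_extChartAt_target x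
  have hcont : ContinuousWithinAt e.symm (range (𝓡∂ n)) (e x) :=
    (continuousAt_extChartAt_symm x).continuousWithinAt
  have h1 : ∀ᶠ q in 𝓝[range (𝓡∂ n)] (e x), q ∈ e.target ∧
      HasMFDerivAt (𝓡∂ n) 𝓘(ℝ, ℝ) g (e.symm q) (0 : EuclideanSpace ℝ (Fin n) →L[ℝ] ℝ) := by
    have h0 : e.symm (e x) = x := e.left_inv (mem_extChartAt_source x)
    have ht : ∀ᶠ q in 𝓝[range (𝓡∂ n)] (e x), q ∈ e.target := extChartAt_target_mem_nhdsWithin x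
    refine ht.and (hcont.eventually (p := fun z => HasMFDerivAt (𝓡∂ n) 𝓘(ℝ, ℝ) g z
      (0 : EuclideanSpace ℝ (Fin n) →L[ℝ] ℝ)) ?_)
    rwa [h0]
  obtain ⟨r, hr, hsub⟩ := exists_ball_inter_range_subset h1
  set C := range (𝓡∂ n) ∩ Metric.ball (e x) r
  have hder : ∀ q ∈ C, HasFDerivWithinAt (g ∘ e.symm)
      (0 : EuclideanSpace ℝ (Fin n) →L[ℝ] ℝ) C q := by
    intro q hq
    have h2 := (hsub hq).2.comp_hasMFDerivWithinAt q
      (mdifferentiableWithinAt_extChartAt_symm (hsub hq).1).hasMFDerivWithinAt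
    have h3 := (hasMFDerivWithinAt_iff_hasFDerivWithinAt.1 h2).mono
      (inter_subset_left : C ⊆ range (𝓡∂ n))
    have h4 : ∀ l : EuclideanSpace ℝ (Fin n) →L[ℝ] EuclideanSpace ℝ (Fin n),
      (0 : EuclideanSpace ℝ (Fin n) →L[ℝ] ℝ).comp l = 0 := fun l => ContinuousLinearMap.zero_comp l
    exact (h4 _) ▸ h3
  have hxC : e x ∈ C := ⟨extChartAt_target_subset_range x hp, Metric.mem_ball_self hr⟩
  have hconst : ∀ q ∈ C, g (e.symm q) = g x := fun q hq => by
    have := (convex_range_inter_ball (e x) r).is_const_of_fderivWithin_eq_zero (𝕜 := ℝ)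
      (fun q hq => (hder q hq).differentiableWithinAt)
      (fun q hq => (hder q hq).fderivWithin (uniqueDiffOn_range_inter_ball (e x) r q hq)) hq hxC
    rwa [comp_apply, comp_apply, e.left_inv (mem_extChartAt_source x)] at this
  filter_upwards [extChartAt_source_mem_nhds (I := 𝓡∂ n) x,
    (continuousAt_extChartAt (I := 𝓡∂ n) x).eventually (Metric.ball_mem_nhds (e x) hr)] with y hy hyr
  have := hconst (e y) ⟨mem_range_self _, hyr⟩
  rwa [e.left_inv hy] at this

theorem exists_local_potential {β : CovectorField n M} (hβ : IsSmoothOneForm β)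
    (hclosed : IsClosedForm β) (a : M) :
    ∃ U : Set M, IsOpen U ∧ a ∈ U ∧ ∃ Ψ : M → ℝ, ContMDiffOn (𝓡∂ n) 𝓘(ℝ, ℝ) ∞ Ψ U ∧
      ∀ y ∈ U, HasMFDerivAt (𝓡∂ n) 𝓘(ℝ, ℝ) Ψ y (β y) := by
  set e := extChartAt (𝓡∂ n) a
  obtain ⟨r, hr, hsub⟩ := exists_ball_inter_range_subset
    (extChartAt_target_mem_nhdsWithin (I := 𝓡∂ n) a)
  set C := range (𝓡∂ n) ∩ Metric.ball (e a) r
  have hCU := uniqueDiffOn_range_inter_ball (n := n) (e a) r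
  have hω : ∀ q ∈ C, ContDiffWithinAt ℝ ∞ (chartForm β a) (range (𝓡∂ n)) q :=
    fun q hq => hβ.contDiffWithinAt_chartForm a (hsub hq)
  have hωC : ContDiffOn ℝ ∞ (chartForm β a) C := fun q hq => (hω q hq).mono inter_subset_left
  have hsymm : ∀ q ∈ C, ∀ v w, fderivWithin ℝ (chartForm β a) C q v w =
      fderivWithin ℝ (chartForm β a) C q w v := by
    intro q hq
    have hd := (hω q hq).differentiableWithinAt (by simp)
    have hU : UniqueDiffWithinAt ℝ (range (𝓡∂ n)) q := (𝓡∂ n).uniqueDiffOn q hq.1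
    have h1 : fderivWithin ℝ (chartForm β a) C q =
        fderivWithin ℝ (chartForm β a) (range (𝓡∂ n)) q :=
      fderivWithin_inter (Metric.isOpen_ball.mem_nhds hq.2)
    have h2 : ∀ v w, fderivWithin ℝ (fun q => chartForm β a q w) (range (𝓡∂ n)) q v =
        fderivWithin ℝ (chartForm β a) (range (𝓡∂ n)) q v w := by
      intro v w
      rw [fderivWithin_clm_apply hU hd (differentiableWithinAt_const w)]
      simp
    intro v w
    rw [h1, ← h2, ← h2]
    exact hclosed a q (hsub hq) v w
  obtain ⟨f, hf⟩ := (convex_range_inter_ball (n := n) (e a) r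
    ).exists_forall_hasFDerivWithinAt_of_fderivWithin_symmetric
      (hωC.differentiableOn (by simp)) fun q hq v _ w _ => hsymm q hq v w
  have hfC : ContDiffOn ℝ ∞ f C := by
    refine (contDiffOn_infty_iff_fderivWithin hCU).2
      ⟨fun q hq => (hf q hq).differentiableWithinAt, hωC.congr fun q hq => ?_⟩
    exact (hf q hq).fderivWithin (hCU q hq)
  set U := e.source ∩ e ⁻¹' Metric.ball (e a) r
  have hUo : IsOpen U := isOpen_extChartAt_preimage' (I := 𝓡∂ n) a Metric.isOpen_ball
  have hUC : ∀ y ∈ U, e y ∈ C := fun y hy => ⟨mem_range_self _, hy.2⟩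
  refine ⟨U, hUo, ⟨mem_extChartAt_source a, Metric.mem_ball_self hr⟩, f ∘ e, ?_, fun y hy => ?_⟩
  · refine hfC.contMDiffOn.comp ((contMDiffOn_extChartAt (I := 𝓡∂ n) (n := ∞) (x := a)).mono ?_) hUC
    intro y hy
    simpa [e] using hy.1
  · have hy' := hy.1
    rw [extChartAt_source] at hy'
    have h1 : HasFDerivWithinAt f (chartForm β a (e y)) (range (𝓡∂ n)) (e y) :=
      (hf (e y) (hUC y hy)).mono_of_mem_nhdsWithin
        (inter_mem self_mem_nhdsWithin (mem_nhdsWithin_of_mem_nhds (Metric.isOpen_ball.mem_nhds hy.2)))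
    have h2 := HasMFDerivWithinAt.comp y h1.hasMFDerivWithinAt
      ((mdifferentiableAt_extChartAt (I := 𝓡∂ n) hy').hasMFDerivAt.hasMFDerivWithinAt (s := univ))
      (fun z _ => mem_range_self _)
    rw [hasMFDerivWithinAt_univ] at h2
    have h3 := mfderivWithin_extChartAt_symm_comp_mfderiv_extChartAt' (I := 𝓡∂ n) hy.1
    have h4 : ∀ z, z = y → ∀ D D' : EuclideanSpace ℝ (Fin n) →L[ℝ] EuclideanSpace ℝ (Fin n),
        D.comp D' = ContinuousLinearMap.id ℝ _ →
        ((β z : EuclideanSpace ℝ (Fin n) →L[ℝ] ℝ).comp D).comp D' = β y := by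
      rintro z rfl D D' h
      exact ContinuousLinearMap.ext fun v => congrArg (β z)
        (congrArg (fun l : EuclideanSpace ℝ (Fin n) →L[ℝ] EuclideanSpace ℝ (Fin n) => l v) h)
    have h5 := h4 _ (e.left_inv hy.1) _ _ h3
    exact h5 ▸ h2

theorem exists_potential [SimplyConnectedSpace M] {β : CovectorField n M}
    (hβ : IsSmoothOneForm β) (hclosed : IsClosedForm β) :
    ∃ φ : M → ℝ, ContMDiff (𝓡∂ n) 𝓘(ℝ, ℝ) ∞ φ ∧
      ∀ x, HasMFDerivAt (𝓡∂ n) 𝓘(ℝ, ℝ) φ x (β x) := by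
  have : LocallyPathConnectedSpace M :=
    ChartedSpace.locallyPathConnectedSpace (EuclideanHalfSpace n) M
  choose U hU hmem Ψ hΨ hd using exists_local_potential hβ hclosed
  obtain ⟨φ, hφ⟩ := exists_glue_of_simplyConnected U hU hmem Ψ fun i j x hx => by
    refine eventually_eq_of_hasMFDerivAt_zero (n := n) (g := fun y => Ψ i y - Ψ j y) ?_
    filter_upwards [((hU i).inter (hU j)).mem_nhds hx] with y hy
    have := (hd i y hy.1).sub (hd j y hy.2)
    rw [sub_self] at this
    exact this
  have hev : ∀ x, φ =ᶠ[𝓝 x] fun y => Ψ x y + (φ x - Ψ x x) := fun x => by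
    filter_upwards [hφ x x (hmem x)] with y hy
    linarith
  refine ⟨φ, fun x => ?_, fun x => ?_⟩
  · have h1 := (hΨ x).contMDiffAt ((hU x).mem_nhds (hmem x))
    exact (h1.add contMDiffAt_const).congr_of_eventuallyEq (hev x)
  · have h1 := (hd x x (hmem x)).add (hasMFDerivAt_const (φ x - Ψ x x) x)
    exact ((add_zero (β x)) ▸ h1).congr_of_eventuallyEq (hev x)

theorem eq_of_forall_hasMFDerivAt [PreconnectedSpace M] {φ ψ : M → ℝ} {β : CovectorField n M}
    (hφ : ∀ x, HasMFDerivAt (𝓡∂ n) 𝓘(ℝ, ℝ) φ x (β x))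
    (hψ : ∀ x, HasMFDerivAt (𝓡∂ n) 𝓘(ℝ, ℝ) ψ x (β x)) (x y : M) :
    φ x - ψ x = φ y - ψ y := by
  have h : IsLocallyConstant fun z => φ z - ψ z := by
    rw [IsLocallyConstant.iff_eventually_eq]
    intro z
    refine eventually_eq_of_hasMFDerivAt_zero (n := n) (Eventually.of_forall fun w => ?_)
    have := (hφ w).sub (hψ w)
    rw [sub_self] at this
    exact this
  exact h.apply_eq_of_preconnectedSpace x y

end Potential

end Finsler

/-! ### Boundary distances of `F + β` with `β` closed -/

namespace Finsler

open Function Set Filter Topology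

section BoundaryDist

variable {n : ℕ} [NeZero n] {M : Type*} [TopologicalSpace M]
  [ChartedSpace (EuclideanHalfSpace n) M]

theorem hasMFDerivAt_of_eq_add_differential {β₁ β₂ : CovectorField n M}
    {φ : C^∞⟮𝓡∂ n, M; 𝓘(ℝ, ℝ), ℝ⟯} (h : β₂ = β₁ + differential φ) {ψ : M → ℝ}
    (hψ : ∀ x, HasMFDerivAt (𝓡∂ n) 𝓘(ℝ, ℝ) ψ x (β₁ x)) (x : M) :
    HasMFDerivAt (𝓡∂ n) 𝓘(ℝ, ℝ) (fun y => ψ y + φ y) x (β₂ x) := by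
  have h1 : HasMFDerivAt (𝓡∂ n) 𝓘(ℝ, ℝ) φ x (differential φ x) :=
    (φ.contMDiff.mdifferentiable (by simp) x).hasMFDerivAt
  rw [h]
  exact (hψ x).add h1

variable [IsManifold (𝓡∂ n) ∞ M]

theorem length_addForm {F : TangentBundle (𝓡∂ n) M → ℝ} (hF : IsFinslerNorm F)
    {β : CovectorField n M} {ψ : M → ℝ} (hψ : ContMDiff (𝓡∂ n) 𝓘(ℝ, ℝ) ∞ ψ)
    (hψβ : ∀ x, HasMFDerivAt (𝓡∂ n) 𝓘(ℝ, ℝ) ψ x (β x)) {γ : ℝ → M}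
    (hγ : ContMDiffOn 𝓘(ℝ, ℝ) (𝓡∂ n) ∞ γ (Icc 0 1))
    (hreg : ∀ t ∈ Icc (0 : ℝ) 1, (velocity (n := n) γ t).2 ≠ 0) :
    length (addForm F β) γ = length F γ + (ψ (γ 1) - ψ (γ 0)) := by
  set b : ℝ → ℝ := fun t => β (velocity (n := n) γ t).1 (velocity (n := n) γ t).2
  have hd : ∀ t ∈ Icc (0 : ℝ) 1, HasDerivWithinAt (ψ ∘ γ) (b t) (Icc 0 1) t := fun t ht => by
    have h1 := (hψβ (γ t)).comp_hasMFDerivWithinAt t ((hγ t ht).mdifferentiableWithinAt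
      (by simp)).hasMFDerivWithinAt
    have h2 : HasFDerivWithinAt (ψ ∘ γ) (_ : ℝ →L[ℝ] ℝ) (Icc 0 1) t :=
      hasMFDerivWithinAt_iff_hasFDerivWithinAt.1 h1
    exact h2.hasDerivWithinAt
  have hsm : ContDiffOn ℝ ∞ (ψ ∘ γ) (Icc 0 1) :=
    (hψ.comp_contMDiffOn hγ).contDiffOn
  have hbc : ContinuousOn b (Icc 0 1) :=
    (hsm.derivWithin (m := ∞) uniqueDiffOn_unitInterval (by simp)).continuousOn.congr fun t ht =>
      ((hd t ht).derivWithin (uniqueDiffOn_unitInterval t ht)).symm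
  have hbi : IntervalIntegrable b MeasureTheory.volume 0 1 :=
    ContinuousOn.intervalIntegrable (by rwa [uIcc_of_le zero_le_one])
  have hFi : IntervalIntegrable (fun t => F (velocity γ t)) MeasureTheory.volume 0 1 :=
    ContinuousOn.intervalIntegrable (by
      rw [uIcc_of_le zero_le_one]
      exact (contDiffOn_apply_velocity hF hγ hreg).continuousOn)
  have hint : ∫ t in (0 : ℝ)..1, b t = ψ (γ 1) - ψ (γ 0) :=
    intervalIntegral.integral_eq_sub_of_hasDerivAt_of_le zero_le_one hsm.continuousOn
      (fun t ht => (hd t (Ioo_subset_Icc_self ht)).hasDerivAt (Icc_mem_nhds ht.1 ht.2)) hbi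
  rw [length, length, ← hint, ← intervalIntegral.integral_add hFi hbi]
  rfl

theorem boundaryDist_addForm {F : TangentBundle (𝓡∂ n) M → ℝ} (hF : IsFinslerNorm F)
    (hrev : IsReversible F) (hadm : IsAdmissible F) {β : CovectorField n M}
    (hβ : IsSmoothOneForm β) (hclosed : IsClosedForm β) (hdual : dualNorm F β < 1)
    (hadm' : IsAdmissible (addForm F β)) {ψ : M → ℝ} (hψ : ContMDiff (𝓡∂ n) 𝓘(ℝ, ℝ) ∞ ψ)
    (hψβ : ∀ x, HasMFDerivAt (𝓡∂ n) 𝓘(ℝ, ℝ) ψ x (β x)) {x x' : M}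
    (hx : x ∈ (𝓡∂ n).boundary M) (hx' : x' ∈ (𝓡∂ n).boundary M) :
    boundaryDist (addForm F β) x x' = boundaryDist F x x' + (ψ x' - ψ x) := by
  by_cases hne : x = x'
  · rw [hne, boundaryDist_self, boundaryDist_self]
    ring
  obtain ⟨γ, ⟨hγ, rfl, rfl⟩, hlen⟩ := hadm'.exists_boundaryDist_eq hx hx' hne
  have hpre : IsPregeodesic F γ := hγ.isPregeodesic hF hβ hclosed
    fun v hv => pos_addForm_of_dualNorm_lt_one hF hrev hdual hv
  rw [hlen, hpre.boundaryDist_eq_length hF hrev hadm hx hx' hne,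
    length_addForm hF hψ hψβ hγ.smooth hγ.regular]

end BoundaryDist

end Finsler

theorem theorem1 (n : ℕ) [NeZero n] (M : Type*) [TopologicalSpace M] [T2Space M] [CompactSpace M]
    [SimplyConnectedSpace M] [ChartedSpace (EuclideanHalfSpace n) M] [IsManifold (𝓡∂ n) ∞ M]
    (hM : ((𝓡∂ n).boundary M).Nonempty)
    (Fr₁ Fr₂ : TangentBundle (𝓡∂ n) M → ℝ) (β₁ β₂ : Finsler.CovectorField n M)
    (hF₁ : Finsler.IsFinslerNorm Fr₁) (hF₂ : Finsler.IsFinslerNorm Fr₂)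
    (hrev₁ : Finsler.IsReversible Fr₁) (hrev₂ : Finsler.IsReversible Fr₂)
    (hFadm₁ : Finsler.IsAdmissible Fr₁) (hFadm₂ : Finsler.IsAdmissible Fr₂)
    (hβ₁ : Finsler.IsSmoothOneForm β₁) (hβ₂ : Finsler.IsSmoothOneForm β₂)
    (hclosed₁ : Finsler.IsClosedForm β₁) (hclosed₂ : Finsler.IsClosedForm β₂)
    (hdual₁ : Finsler.dualNorm Fr₁ β₁ < 1) (hdual₂ : Finsler.dualNorm Fr₂ β₂ < 1)
    (hadm₁ : Finsler.IsAdmissible (Finsler.addForm Fr₁ β₁))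
    (hadm₂ : Finsler.IsAdmissible (Finsler.addForm Fr₂ β₂)) :
    (∀ x ∈ (𝓡∂ n).boundary M, ∀ x' ∈ (𝓡∂ n).boundary M,
      Finsler.boundaryDist (Finsler.addForm Fr₁ β₁) x x' =
        Finsler.boundaryDist (Finsler.addForm Fr₂ β₂) x x') ↔
    ((∃! φ : C^∞⟮𝓡∂ n, M; 𝓘(ℝ, ℝ), ℝ⟯,
        (∀ x ∈ (𝓡∂ n).boundary M, φ x = 0) ∧
        β₂ = β₁ + Finsler.differential φ) ∧
      ∀ x ∈ (𝓡∂ n).boundary M, ∀ x' ∈ (𝓡∂ n).boundary M,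
        Finsler.boundaryDist Fr₁ x x' = Finsler.boundaryDist Fr₂ x x') := by

  obtain ⟨ψ₁, hψ₁, hd₁⟩ := Finsler.exists_potential hβ₁ hclosed₁
  obtain ⟨ψ₂, hψ₂, hd₂⟩ := Finsler.exists_potential hβ₂ hclosed₂
  have e₁ : ∀ x ∈ (𝓡∂ n).boundary M, ∀ x' ∈ (𝓡∂ n).boundary M,
      Finsler.boundaryDist (Finsler.addForm Fr₁ β₁) x x' =
        Finsler.boundaryDist Fr₁ x x' + (ψ₁ x' - ψ₁ x) := fun x hx x' hx' =>
    Finsler.boundaryDist_addForm hF₁ hrev₁ hFadm₁ hβ₁ hclosed₁ hdual₁ hadm₁ hψ₁ hd₁ hx hx'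
  have e₂ : ∀ x ∈ (𝓡∂ n).boundary M, ∀ x' ∈ (𝓡∂ n).boundary M,
      Finsler.boundaryDist (Finsler.addForm Fr₂ β₂) x x' =
        Finsler.boundaryDist Fr₂ x x' + (ψ₂ x' - ψ₂ x) := fun x hx x' hx' =>
    Finsler.boundaryDist_addForm hF₂ hrev₂ hFadm₂ hβ₂ hclosed₂ hdual₂ hadm₂ hψ₂ hd₂ hx hx'
  obtain ⟨x₀, hx₀⟩ := hM
  constructor
  · intro h
    have hsum : ∀ x ∈ (𝓡∂ n).boundary M, ∀ x' ∈ (𝓡∂ n).boundary M,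
        Finsler.boundaryDist Fr₁ x x' = Finsler.boundaryDist Fr₂ x x' ∧
          ψ₁ x' - ψ₁ x = ψ₂ x' - ψ₂ x := by
      intro x hx x' hx'
      have h1 := h x hx x' hx'
      have h2 := h x' hx' x hx
      rw [e₁ x hx x' hx', e₂ x hx x' hx'] at h1
      rw [e₁ x' hx' x hx, e₂ x' hx' x hx, Finsler.boundaryDist_comm hF₁ hrev₁ hFadm₁ hx' hx,
        Finsler.boundaryDist_comm hF₂ hrev₂ hFadm₂ hx' hx] at h2
      constructor <;> linarith
    refine ⟨?_, fun x hx x' hx' => (hsum x hx x' hx').1⟩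
    set c : ℝ := ψ₂ x₀ - ψ₁ x₀ with hc
    let φ : C^∞⟮𝓡∂ n, M; 𝓘(ℝ, ℝ), ℝ⟯ :=
      ⟨fun x => ψ₂ x - ψ₁ x - c, (hψ₂.sub hψ₁).sub contMDiff_const⟩
    have hφ0 : ∀ x ∈ (𝓡∂ n).boundary M, φ x = 0 := by
      intro x hx
      have := (hsum x₀ hx₀ x hx).2
      change ψ₂ x - ψ₁ x - c = 0
      linarith
    have hφd : β₂ = β₁ + Finsler.differential φ := by
      funext x
      let D₁ : EuclideanSpace ℝ (Fin n) →L[ℝ] ℝ := β₁ x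
      let D₂ : EuclideanSpace ℝ (Fin n) →L[ℝ] ℝ := β₂ x
      let D : EuclideanSpace ℝ (Fin n) →L[ℝ] ℝ := D₂ - D₁ - 0
      have h1 : HasMFDerivAt (𝓡∂ n) 𝓘(ℝ, ℝ) φ x D :=
        ((hd₂ x).sub (hd₁ x)).sub (hasMFDerivAt_const c x)
      have h2 : D₂ = D₁ + D := by simp only [D, sub_zero, add_sub_cancel]
      exact h2.trans (congrArg (D₁ + ·) h1.mfderiv.symm)
    refine ⟨φ, ⟨hφ0, hφd⟩, fun φ' hφ' => ?_⟩
    ext x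
    have h1 := Finsler.eq_of_forall_hasMFDerivAt
      (Finsler.hasMFDerivAt_of_eq_add_differential hφ'.2 hd₁)
      (Finsler.hasMFDerivAt_of_eq_add_differential hφd hd₁) x x₀
    rw [hφ'.1 x₀ hx₀, hφ0 x₀ hx₀] at h1
    linarith
  · rintro ⟨⟨φ, ⟨hφ0, hφd⟩, -⟩, hdist⟩ x hx x' hx'
    have h1 := Finsler.eq_of_forall_hasMFDerivAt hd₂
      (Finsler.hasMFDerivAt_of_eq_add_differential hφd hd₁) x x'
    rw [hφ0 x hx, hφ0 x' hx'] at h1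
    rw [e₁ x hx x' hx', e₂ x hx x' hx', hdist x hx x' hx']
    linarith
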